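/- Let $(M,g)$ be a smooth $2$-dimensional pseudo-Riemannian manifold which is either positive-definite (signature "$(0,2)$", with $\eta=\mathrm{diag}(1,1)$) or Lorentzian (signature "$(1,1)$", with $\eta=\mathrm{diag}(-1,1)$), and suppose that it is (strongly) spin: it is oriented, time-oriented in the Lorentzian case, and equipped with a lift of its bundle of oriented (and time-oriented) orthonormal frames from $SO_0(V)$, $V=(\mathbb{R}^2,\eta)$, to the two-fold cover $\mathrm{Spin}(V)$ of $SO_0(V)$. Use the Clifford convention $v\cdot v=\eta(v,v)\mathbb{1}$, and let $\mathsf{S}=\mathbb{R}^2$ be the irreducible real pinor module given by $\Gamma_1=\sigma_3,\ \Gamma_2=\sigma_1$ in signature $(0,2)$ and by $\Gamma_0=i\sigma_2,\ \Gamma_1=\sigma_1$ in signature $(1,1)$. Let $\underline{S}$ be the associated spinor bundle and $\nabla$ the Levi-Civita connection and its lift to $\underline{S}$. A skew-symmetric endomorphism $A$ of $TM$ acts on spinors by $A\cdot\epsilon=\tfrac14 A_{\mu\nu}\Gamma^{\mu\nu}\epsilon$, where $A_{\mu\nu}=g(e_\mu,Ae_\nu)$ in an orthonormal frame. Let $*$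 be the Hodge star on vectors, $X\wedge *Y=g(X,Y)\,\mathrm{vol}$, where $\mathrm{vol}=e_\mu\wedge e_\nu$ for an oriented (time-oriented) orthonormal frame $(e_\mu,e_\nu)$ (timelike vector first). Let $B$ be an admissible bilinear form on $\mathsf{S}$, that is, $B(\epsilon,\epsilon')=\varsigma_B B(\epsilon',\epsilon)$ and $B(\epsilon,v\cdot\epsilon')=\tau_B B(v\cdot\epsilon,\epsilon')$ for signs $\varsigma_B,\tau_B\in\{\pm1\}$, and, in signature $(1,1)$, the two chiral subspaces $\mathsf{S}_\pm$ are either mutually $B$-orthogonal or both $B$-isotropic. Let $\langle-,-\rangle$ be the induced bilinear form on $\underline{S}$, and let $\kappa$ be the Dirac current, $g(\kappa(\epsilon,\epsilon'),X)=\langle\epsilon,X\cdot\epsilon'\rangle$, with $\kappa_\epsilon=\kappa(\epsilon,\epsilon)$. Let $b\in C^\infty(M)$ and define, for vector fields $X$ and spinor fields $\epsilon$, $$\beta(X)\epsilon=\begin{cases} b\,X\cdot\epsilon & \text{if }\varsigma_B=-1,\\ b\,(*X)\cdot\epsilon & \text{if }\varsigma_B=+1.\end{cases}$$ Then $\beta$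 is a smooth one-form with values in $\mathrm{End}\,\underline{S}$ and $D=\nabla-\beta$ is an admissible connection, that is: 1. for every $\epsilon$, the endomorphism $\gamma(\epsilon,\epsilon)$ of $TM$ given by $\gamma(\epsilon,\epsilon)X=-2\kappa(\epsilon,\beta(X)\epsilon)$ is $g$-skew-symmetric; 2. $\beta(\kappa_\epsilon)\epsilon+\gamma(\epsilon,\epsilon)\cdot\epsilon=0$ for every $\epsilon$; 3. $\mathscr{L}_{\kappa_\epsilon}\beta=0$ for every Killing spinor $\epsilon$, i.e. every smooth section $\epsilon$ of $\underline{S}$ with $D\epsilon=0$. Here $(\mathscr{L}_Y\beta)(X)\zeta=\mathscr{L}_Y(\beta(X)\zeta)-\beta([Y,X])\zeta-\beta(X)\mathscr{L}_Y\zeta$ for smooth vector fields $X$ and smooth spinor fields $\zeta$, with the Kosmann Lie derivative $\mathscr{L}_Y\zeta=\nabla_Y\zeta-(\nabla Y)\cdot\zeta$. -/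

import Mathlib

open Bundle Set Manifold VectorField
open scoped Manifold ContDiff Topology Bundle Matrix

noncomputable section

/-- The two signatures considered: `(0,2)` (positive-definite with the convention `v · v = η(v,v)`)
and `(1,1)` (mostly positive). -/
inductive Sig
  | riemannian
  | lorentzian

namespace Sig

/-- The diagonal entries of the inner product `η` in the standard orthonormal basis of `V`. -/
def eta : Sig → Fin 2 → ℝ
  | riemannian => ![1, 1]
  | lorentzian => ![-1, 1]

theorem eta_mul_self (s : Sig) (a : Fin 2) : s.eta a * s.eta a = 1 := by
  cases s <;> fin_cases a <;> simp [eta]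

end Sig

/-- The model space of a surface. -/
abbrev Plane := EuclideanSpace ℝ (Fin 2)

/-- A smooth pseudo-Riemannian metric of signature `s` on a surface `M`. -/
structure SurfaceMetric (s : Sig) (M : Type*) [TopologicalSpace M] [ChartedSpace Plane M]
    [IsManifold (𝓡 2) ∞ M] where
  inner : ∀ x : M, TangentSpace (𝓡 2) x →L[ℝ] TangentSpace (𝓡 2) x →L[ℝ] ℝ
  symm : ∀ (x : M) (v w : TangentSpace (𝓡 2) x), inner x v w = inner x w v
  signature : ∀ x : M, ∃ e : Fin 2 → TangentSpace (𝓡 2) x,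
    ∀ a b, inner x (e a) (e b) = if a = b then s.eta a else 0
  smooth : ContMDiff (𝓡 2) ((𝓡 2).prod 𝓘(ℝ, Plane →L[ℝ] Plane →L[ℝ] ℝ)) ∞
    (fun x ↦ TotalSpace.mk' (Plane →L[ℝ] Plane →L[ℝ] ℝ)
      (E := fun x : M ↦ TangentSpace (𝓡 2) x →L[ℝ] TangentSpace (𝓡 2) x →L[ℝ] ℝ) x (inner x))

/-- Differentiability at a point of a (not necessarily continuous) vector field. -/
abbrev DiffVF {M : Type*} [TopologicalSpace M] [ChartedSpace Plane M]
    [IsManifold (𝓡 2) ∞ M] (X : ∀ x : M, TangentSpace (𝓡 2) x) (x : M) : Prop :=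
  MDifferentiableAt (𝓡 2) ((𝓡 2).prod 𝓘(ℝ, Plane)) (fun y ↦ TotalSpace.mk' Plane y (X y)) x

namespace SurfaceMetric

variable {s : Sig} {M : Type*} [TopologicalSpace M] [ChartedSpace Plane M]
  [IsManifold (𝓡 2) ∞ M] (g : SurfaceMetric s M)

theorem diffVF_extend {x : M} (v : TangentSpace (𝓡 2) x) :
    DiffVF (FiberBundle.extend Plane (E := fun y : M ↦ TangentSpace (𝓡 2) y) v) x :=
  FiberBundle.mdifferentiableAt_extend ..

/-- Expansion of a tangent vector in an orthonormal basis. -/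
theorem expand {x : M} (e : Fin 2 → TangentSpace (𝓡 2) x)
    (he : ∀ a b, g.inner x (e a) (e b) = if a = b then s.eta a else 0)
    (v : TangentSpace (𝓡 2) x) : v = ∑ a, (s.eta a * g.inner x v (e a)) • e a := by
  have hli : LinearIndependent ℝ e := by
    rw [Fintype.linearIndependent_iff]
    intro c hc a
    have := congrArg (fun w ↦ g.inner x w (e a)) hc
    have h1 := s.eta_mul_self a
    simp only [map_sum, map_smul, sum_apply, smul_apply,
      smul_eq_mul, he, map_zero, zero_apply] at this
    simp at this
    rcases this with h | h
    · exact h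
    · rw [h] at h1; simp at h1
  have hcard : Fintype.card (Fin 2) = Module.finrank ℝ (TangentSpace (𝓡 2) x) := by
    change _ = Module.finrank ℝ Plane
    simp
  let b := basisOfLinearIndependentOfCardEqFinrank hli hcard
  have hb : ∀ a, b a = e a := fun a ↦ by simp [b]
  have hv := (b.sum_repr v).symm
  simp only [hb] at hv
  have hc : ∀ a, s.eta a * g.inner x v (e a) = b.repr v a := by
    intro a
    have h1 := s.eta_mul_self a
    have : g.inner x v (e a) = b.repr v a * s.eta a := by
      conv_lhs => rw [hv]
      simp only [map_sum, map_smul, sum_apply, smul_apply,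
        smul_eq_mul, he]
      simp
    rw [this]; linear_combination (b.repr v a) * h1
  simp only [hc]
  exact hv

theorem eq_of_forall {x : M} {v w : TangentSpace (𝓡 2) x}
    (h : ∀ z, g.inner x v z = g.inner x w z) : v = w := by
  obtain ⟨e, he⟩ := g.signature x
  rw [g.expand e he v, g.expand e he w]
  simp [h]

/-- Every linear form on `T_x M` is represented by a vector, linearly in the form. -/
theorem exists_sharp (x : M) : ∃ S : (TangentSpace (𝓡 2) x →L[ℝ] ℝ) →L[ℝ] TangentSpace (𝓡 2) x,
    ∀ φ z, g.inner x (S φ) z = φ z := by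
  obtain ⟨e, he⟩ := g.signature x
  let e' : Fin 2 → Plane := e
  let S : (Plane →L[ℝ] ℝ) →L[ℝ] Plane :=
    ∑ a, (s.eta a) • (ContinuousLinearMap.apply ℝ ℝ (e' a)).smulRight (e' a)
  have hS : ∀ φ : Plane →L[ℝ] ℝ, S φ = ∑ a, (s.eta a * φ (e' a)) • e' a := by
    intro φ
    simp [S, mul_smul]
  have hS' : ∃ S : (TangentSpace (𝓡 2) x →L[ℝ] ℝ) →L[ℝ] TangentSpace (𝓡 2) x,
      ∀ φ, S φ = ∑ a, (s.eta a * φ (e a)) • e a := ⟨S, hS⟩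
  obtain ⟨S, hS⟩ := hS'
  refine ⟨S, fun φ z ↦ ?_⟩
  conv_rhs => rw [g.expand e he z]
  rw [hS φ]
  simp only [map_sum, map_smul, sum_apply, smul_apply, smul_eq_mul, g.symm x z]
  exact Finset.sum_congr rfl fun a _ ↦ by ring

/-- The inverse `T*_x M → T_x M` of the musical isomorphism. -/
def sharp (x : M) : (TangentSpace (𝓡 2) x →L[ℝ] ℝ) →L[ℝ] TangentSpace (𝓡 2) x :=
  (g.exists_sharp x).choose

theorem inner_sharp (x : M) (φ : TangentSpace (𝓡 2) x →L[ℝ] ℝ) (z : TangentSpace (𝓡 2) x) :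
    g.inner x (g.sharp x φ) z = φ z :=
  (g.exists_sharp x).choose_spec φ z

theorem mdifferentiableAt_inner {X Y : ∀ x : M, TangentSpace (𝓡 2) x} {x : M}
    (hX : DiffVF X x) (hY : DiffVF Y x) :
    MDifferentiableAt (𝓡 2) 𝓘(ℝ) (fun y ↦ g.inner y (X y) (Y y)) x := by
  have h := (g.smooth.mdifferentiable (by simp) x).clm_bundle_apply₂
    (E₃ := Bundle.Trivial M ℝ) hX hY
  rw [mdifferentiableAt_totalSpace] at h
  exact h.2

/-- The right-hand side of the Koszul formula, which is `g(∇_X Y, Z)`. -/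
def koszul (X Y Z : ∀ x : M, TangentSpace (𝓡 2) x) (x : M) : ℝ :=
  (1 / 2) * (mvfderiv (𝓡 2) (fun y ↦ g.inner y (Y y) (Z y)) x (X x)
    + mvfderiv (𝓡 2) (fun y ↦ g.inner y (X y) (Z y)) x (Y x)
    - mvfderiv (𝓡 2) (fun y ↦ g.inner y (X y) (Y y)) x (Z x)
    + g.inner x (mlieBracket (𝓡 2) X Y x) (Z x)
    - g.inner x (mlieBracket (𝓡 2) X Z x) (Y x)
    - g.inner x (mlieBracket (𝓡 2) Y Z x) (X x))

theorem koszul_tensorial_left {Y Z : ∀ x : M, TangentSpace (𝓡 2) x} {x : M}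
    (hY : DiffVF Y x) (hZ : DiffVF Z x) :
    TensorialAt (𝓡 2) Plane (fun X ↦ g.koszul X Y Z x) x where
  smul {f X} hf hX := by
    have h1 := mvfderiv_mul hf (g.mdifferentiableAt_inner hX hZ)
    have h2 := mvfderiv_mul hf (g.mdifferentiableAt_inner hX hY)
    have e1 : (fun y ↦ g.inner y ((f • X) y) (Z y)) = f * fun y ↦ g.inner y (X y) (Z y) := by
      ext y; simp
    have e2 : (fun y ↦ g.inner y ((f • X) y) (Y y)) = f * fun y ↦ g.inner y (X y) (Y y) := by
      ext y; simp
    simp only [koszul, e1, e2, h1, h2, mlieBracket_smul_left hf hX]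
    simp
    ring
  add {X X'} hX hX' := by
    have h1 := mvfderiv_add (g.mdifferentiableAt_inner hX hZ) (g.mdifferentiableAt_inner hX' hZ)
    have h2 := mvfderiv_add (g.mdifferentiableAt_inner hX hY) (g.mdifferentiableAt_inner hX' hY)
    have e1 : (fun y ↦ g.inner y ((X + X') y) (Z y)) = (fun y ↦ g.inner y (X y) (Z y))
      + fun y ↦ g.inner y (X' y) (Z y) := by ext y; simp
    have e2 : (fun y ↦ g.inner y ((X + X') y) (Y y)) = (fun y ↦ g.inner y (X y) (Y y))
      + fun y ↦ g.inner y (X' y) (Y y) := by ext y; simp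
    simp only [koszul, e1, e2, h1, h2, mlieBracket_add_left hX hX']
    simp
    ring

theorem koszul_tensorial_right {X Y : ∀ x : M, TangentSpace (𝓡 2) x} {x : M}
    (hX : DiffVF X x) (hY : DiffVF Y x) :
    TensorialAt (𝓡 2) Plane (fun Z ↦ g.koszul X Y Z x) x where
  smul {f Z} hf hZ := by
    have h1 := mvfderiv_mul hf (g.mdifferentiableAt_inner hX hZ)
    have h2 := mvfderiv_mul hf (g.mdifferentiableAt_inner hY hZ)
    have e1 : (fun y ↦ g.inner y (X y) ((f • Z) y)) = f * fun y ↦ g.inner y (X y) (Z y) := by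
      ext y; simp
    have e2 : (fun y ↦ g.inner y (Y y) ((f • Z) y)) = f * fun y ↦ g.inner y (Y y) (Z y) := by
      ext y; simp
    simp only [koszul, e1, e2, h1, h2, mlieBracket_smul_right hf hZ]
    simp
    simp only [g.symm x (Z x) (Y x), g.symm x (Z x) (X x)]
    ring
  add {Z Z'} hZ hZ' := by
    have h1 := mvfderiv_add (g.mdifferentiableAt_inner hX hZ) (g.mdifferentiableAt_inner hX hZ')
    have h2 := mvfderiv_add (g.mdifferentiableAt_inner hY hZ) (g.mdifferentiableAt_inner hY hZ')
    have e1 : (fun y ↦ g.inner y (X y) ((Z + Z') y)) = (fun y ↦ g.inner y (X y) (Z y))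
      + fun y ↦ g.inner y (X y) (Z' y) := by ext y; simp
    have e2 : (fun y ↦ g.inner y (Y y) ((Z + Z') y)) = (fun y ↦ g.inner y (Y y) (Z y))
      + fun y ↦ g.inner y (Y y) (Z' y) := by ext y; simp
    simp only [koszul, e1, e2, h1, h2, mlieBracket_add_right hZ hZ']
    simp
    ring

theorem koszul_add_middle {X Y Y' Z : ∀ x : M, TangentSpace (𝓡 2) x} {x : M}
    (hX : DiffVF X x) (hY : DiffVF Y x) (hY' : DiffVF Y' x) (hZ : DiffVF Z x) :
    g.koszul X (Y + Y') Z x = g.koszul X Y Z x + g.koszul X Y' Z x := by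
  have h1 := mvfderiv_add (g.mdifferentiableAt_inner hY hZ) (g.mdifferentiableAt_inner hY' hZ)
  have h2 := mvfderiv_add (g.mdifferentiableAt_inner hX hY) (g.mdifferentiableAt_inner hX hY')
  have e1 : (fun y ↦ g.inner y ((Y + Y') y) (Z y)) = (fun y ↦ g.inner y (Y y) (Z y))
    + fun y ↦ g.inner y (Y' y) (Z y) := by ext y; simp
  have e2 : (fun y ↦ g.inner y (X y) ((Y + Y') y)) = (fun y ↦ g.inner y (X y) (Y y))
    + fun y ↦ g.inner y (X y) (Y' y) := by ext y; simp
  simp only [koszul, e1, e2, h1, h2, mlieBracket_add_right hY hY', mlieBracket_add_left hY hY']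
  simp
  ring

theorem koszul_smul_middle {f : M → ℝ} {X Y Z : ∀ x : M, TangentSpace (𝓡 2) x} {x : M}
    (hf : MDifferentiableAt (𝓡 2) 𝓘(ℝ) f x)
    (hX : DiffVF X x) (hY : DiffVF Y x) (hZ : DiffVF Z x) :
    g.koszul X (f • Y) Z x =
      f x * g.koszul X Y Z x + mvfderiv (𝓡 2) f x (X x) * g.inner x (Y x) (Z x) := by
  have h1 := mvfderiv_mul hf (g.mdifferentiableAt_inner hY hZ)
  have h2 := mvfderiv_mul hf (g.mdifferentiableAt_inner hX hY)
  have e1 : (fun y ↦ g.inner y ((f • Y) y) (Z y)) = f * fun y ↦ g.inner y (Y y) (Z y) := by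
    ext y; simp
  have e2 : (fun y ↦ g.inner y (X y) ((f • Y) y)) = f * fun y ↦ g.inner y (X y) (Y y) := by
    ext y; simp
  simp only [koszul, e1, e2, h1, h2, mlieBracket_smul_right hf hY, mlieBracket_smul_left hf hY]
  simp
  simp only [g.symm x (X x) (Y x)]
  ring

open scoped Classical in
/-- The Levi-Civita derivative `v ↦ ∇_v Y` at `x`, determined by the Koszul formula (and given the
junk value `0` when `Y` is not differentiable at `x`). -/
def leviCivitaAux (Y : ∀ x : M, TangentSpace (𝓡 2) x) (x : M) :
    TangentSpace (𝓡 2) x →L[ℝ] TangentSpace (𝓡 2) x :=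
  if hY : DiffVF Y x then
    (g.sharp x).comp (TensorialAt.mkHom₂ (fun X Z ↦ g.koszul X Y Z x) x
      (fun _ hZ ↦ g.koszul_tensorial_left hY hZ) (fun _ hX ↦ g.koszul_tensorial_right hX hY))
  else 0

/-- The Koszul formula. -/
theorem inner_leviCivitaAux {X Y Z : ∀ x : M, TangentSpace (𝓡 2) x} {x : M}
    (hX : DiffVF X x) (hY : DiffVF Y x) (hZ : DiffVF Z x) :
    g.inner x (g.leviCivitaAux Y x (X x)) (Z x) = g.koszul X Y Z x := by
  rw [leviCivitaAux, dif_pos hY, ContinuousLinearMap.comp_apply, inner_sharp]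
  exact TensorialAt.mkHom₂_apply _ _ hX hZ

/-- The Levi-Civita connection of `g`. -/
def leviCivita : CovariantDerivative (𝓡 2) Plane (TangentSpace (𝓡 2) : M → Type _) where
  toFun := g.leviCivitaAux
  isCovariantDerivativeOnUniv :=
    { add := by
        intro Y Y' x hY hY' _
        ext1 v
        refine g.eq_of_forall fun z ↦ ?_
        have hv := diffVF_extend v
        have hz := diffVF_extend z
        have k0 := g.inner_leviCivitaAux hv (mdifferentiableAt_add_section hY hY') hz
        have k1 := g.inner_leviCivitaAux hv hY hz
        have k2 := g.inner_leviCivitaAux hv hY' hz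
        rw [FiberBundle.extend_apply_self, FiberBundle.extend_apply_self] at k0 k1 k2
        rw [add_apply, map_add, add_apply, k1, k2]
        exact k0.trans (g.koszul_add_middle hv hY hY' hz)
      leibniz := by
        intro Y f x hY hf _
        ext1 v
        refine g.eq_of_forall fun z ↦ ?_
        have hv := diffVF_extend v
        have hz := diffVF_extend z
        have k0 := g.inner_leviCivitaAux hv (hf.smul_section hY) hz
        have k1 := g.inner_leviCivitaAux hv hY hz
        rw [FiberBundle.extend_apply_self, FiberBundle.extend_apply_self] at k0 k1
        have k2 := g.koszul_smul_middle hf hv hY hz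
        rw [FiberBundle.extend_apply_self, FiberBundle.extend_apply_self] at k2
        refine (k0.trans k2).trans ?_
        simp [k1] }

theorem inner_leviCivita {X Y Z : ∀ x : M, TangentSpace (𝓡 2) x} {x : M}
    (hX : DiffVF X x) (hY : DiffVF Y x) (hZ : DiffVF Z x) :
    g.inner x (g.leviCivita Y x (X x)) (Z x) = g.koszul X Y Z x :=
  g.inner_leviCivitaAux hX hY hZ

/-- The Levi-Civita connection is torsion-free. -/
theorem leviCivita_torsion_free {X Y : ∀ x : M, TangentSpace (𝓡 2) x} {x : M}
    (hX : DiffVF X x) (hY : DiffVF Y x) :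
    g.leviCivita Y x (X x) - g.leviCivita X x (Y x) = mlieBracket (𝓡 2) X Y x := by
  refine g.eq_of_forall fun z ↦ ?_
  have hz := diffVF_extend z
  have k1 := g.inner_leviCivita hX hY hz
  have k2 := g.inner_leviCivita hY hX hz
  simp only [FiberBundle.extend_apply_self] at k1 k2
  rw [map_sub, sub_apply, k1, k2]
  have e : (fun y ↦ g.inner y (X y) (Y y)) = fun y ↦ g.inner y (Y y) (X y) := by
    ext y; exact g.symm y _ _
  rw [koszul, koszul, e, mlieBracket_swap_apply (V := Y) (W := X)]
  simp
  ring

/-- The Levi-Civita connection is compatible with the metric. -/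
theorem leviCivita_metric {X Y Z : ∀ x : M, TangentSpace (𝓡 2) x} {x : M}
    (hX : DiffVF X x) (hY : DiffVF Y x) (hZ : DiffVF Z x) :
    mvfderiv (𝓡 2) (fun y ↦ g.inner y (Y y) (Z y)) x (X x) =
      g.inner x (g.leviCivita Y x (X x)) (Z x) + g.inner x (Y x) (g.leviCivita Z x (X x)) := by
  rw [g.symm x (Y x), g.inner_leviCivita hX hY hZ, g.inner_leviCivita hX hZ hY]
  have e : (fun y ↦ g.inner y (Z y) (Y y)) = fun y ↦ g.inner y (Y y) (Z y) := by
    ext y; exact g.symm y _ _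
  rw [koszul, koszul, e, mlieBracket_swap_apply (V := Z) (W := Y)]
  simp
  ring

end SurfaceMetric

/-! ### Clifford algebra, pinor module and admissible bilinears -/

namespace Sig

variable (s : Sig)

/-- The quadratic form `v ↦ η(v, v)` on `V = ℝ²`. -/
def Q : QuadraticForm ℝ (Fin 2 → ℝ) := QuadraticMap.weightedSumSquares ℝ s.eta

/-- The gamma matrices: `σ₃, σ₁` in signature `(0,2)` and `Ω = iσ₂, σ₁` in signature `(1,1)`. -/
def gamma : Sig → Fin 2 → Matrix (Fin 2) (Fin 2) ℝ
  | riemannian => ![!![1, 0; 0, -1], !![0, 1; 1, 0]]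
  | lorentzian => ![!![0, 1; -1, 0], !![0, 1; 1, 0]]

/-- The top gamma matrix `Γ_*`. -/
def gammaStar : Matrix (Fin 2) (Fin 2) ℝ := s.gamma 0 * s.gamma 1

/-- The matrix `v^a Γ_a` of a vector `v`. -/
def gammaVec : (Fin 2 → ℝ) →ₗ[ℝ] Matrix (Fin 2) (Fin 2) ℝ :=
  ∑ a, (LinearMap.proj a : (Fin 2 → ℝ) →ₗ[ℝ] ℝ).smulRight (s.gamma a)

theorem gammaVec_apply (v : Fin 2 → ℝ) : s.gammaVec v = ∑ a, v a • s.gamma a := by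
  simp [gammaVec]

theorem gammaVec_mul_self (v : Fin 2 → ℝ) :
    s.gammaVec v * s.gammaVec v = algebraMap ℝ (Matrix (Fin 2) (Fin 2) ℝ) (s.Q v) := by
  cases s <;> ext i j <;> fin_cases i <;> fin_cases j <;>
    simp [gammaVec_apply, Q, gamma, eta, Matrix.mul_apply, QuadraticMap.weightedSumSquares_apply,
      Fin.sum_univ_two, Algebra.algebraMap_eq_smul_one] <;> ring

/-- The representation `Cl(V) → ℝ(2)` extending `e_a ↦ Γ_a`. -/
def rep : CliffordAlgebra s.Q →ₐ[ℝ] Matrix (Fin 2) (Fin 2) ℝ :=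
  CliffordAlgebra.lift s.Q ⟨s.gammaVec, s.gammaVec_mul_self⟩

end Sig

/-- The underlying space `ℝ²` of the irreducible real pinor module. -/
abbrev Pinor := Fin 2 → ℝ

namespace Sig

variable (s : Sig)

/-- The action of the Clifford algebra on the pinor module. -/
def act (c : CliffordAlgebra s.Q) : Pinor →L[ℝ] Pinor :=
  LinearMap.toContinuousLinearMap (Matrix.toLin' (s.rep c))

theorem act_mul (c d : CliffordAlgebra s.Q) (e : Pinor) :
    s.act (c * d) e = s.act c (s.act d e) := by
  simp [act]

theorem act_one (e : Pinor) : s.act 1 e = e := by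
  simp [act]

/-- The matrix `Γ^{ab}`: antisymmetrised product of gamma matrices, with indices raised. -/
def gammaUpper (a b : Fin 2) : Matrix (Fin 2) (Fin 2) ℝ :=
  (s.eta a * s.eta b / 2) • (s.gamma a * s.gamma b - s.gamma b * s.gamma a)

/-- A bilinear form on the pinor module is admissible with symmetry `symB` and type `typeB`
if it is `symB`-symmetric, Clifford multiplication by vectors is `typeB`-symmetric, and the
`±1`-eigenspaces `S_±` of `Γ_*` (which are non-zero only in signature `(1,1)`, where they are
the irreducible `so(V)`-submodules) are mutually orthogonal or both isotropic. -/
structure IsAdmissible (B : LinearMap.BilinForm ℝ Pinor) (symB typeB : ℤˣ) : Prop where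
  symmetry : ∀ e e' : Pinor, B e e' = ((symB : ℤ) : ℝ) * B e' e
  cliffordType : ∀ (v : Fin 2 → ℝ) (e e' : Pinor), B e (s.gammaVec v *ᵥ e') =
    ((typeB : ℤ) : ℝ) * B (s.gammaVec v *ᵥ e) e'
  isotropy :
    (∀ e e' : Pinor, s.gammaStar *ᵥ e = e → s.gammaStar *ᵥ e' = -e' → B e e' = 0) ∨
    ((∀ e e' : Pinor, s.gammaStar *ᵥ e = e → s.gammaStar *ᵥ e' = e' → B e e' = 0) ∧
      (∀ e e' : Pinor, s.gammaStar *ᵥ e = -e → s.gammaStar *ᵥ e' = -e' → B e e' = 0))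

end Sig

/-! ### Spin structures and the spinor bundle -/

/-- The components `v^a` of a tangent vector in an orthonormal basis `e` of `T_x M`. -/
def SurfaceMetric.components {s : Sig} {M : Type*} [TopologicalSpace M] [ChartedSpace Plane M]
    [IsManifold (𝓡 2) ∞ M] (g : SurfaceMetric s M) {x : M} (e : Fin 2 → TangentSpace (𝓡 2) x) :
    TangentSpace (𝓡 2) x →ₗ[ℝ] Fin 2 → ℝ :=
  LinearMap.pi fun a ↦ s.eta a • ((g.inner x (e a) : TangentSpace (𝓡 2) x →L[ℝ] ℝ) :
    TangentSpace (𝓡 2) x →ₗ[ℝ] ℝ)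

/-- A spin structure on `(M, g)`, given by local data: an open cover, smooth local orthonormal
frames, and a smooth cocycle with values in the spin group lifting, through the covering
`c ↦ (v ↦ c v c⁻¹)` of the connected component `SO₀(V)`, the transition functions between the
frames. (Mathlib's `spinGroup` consists of the even elements `c` of the Lipschitz group with
`c̃ c = 1`; it is the two-fold cover of `SO₀(V)`.) Such a structure exists only if `(M, g)` is
orientable and, in Lorentzian signature, time-orientable; the frames determine the orientations. -/
structure SpinStructure {s : Sig} {M : Type*} [TopologicalSpace M] [ChartedSpace Plane M]
    [IsManifold (𝓡 2) ∞ M] (g : SurfaceMetric s M) (ι : Type*) where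
  domain : ι → Set M
  isOpen_domain : ∀ i, IsOpen (domain i)
  /-- a choice of a frame near each point -/
  indexAt : M → ι
  mem_domain_indexAt : ∀ x, x ∈ domain (indexAt x)
  frame : ι → Fin 2 → ∀ x : M, TangentSpace (𝓡 2) x
  smooth_frame : ∀ i a, ContMDiffOn (𝓡 2) ((𝓡 2).prod 𝓘(ℝ, Plane)) ∞
    (fun x ↦ TotalSpace.mk' Plane x (frame i a x)) (domain i)
  orthonormal : ∀ i, ∀ x ∈ domain i, ∀ a b,
    g.inner x (frame i a x) (frame i b x) = if a = b then s.eta a else 0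
  /-- the lift to the spin group of the change from frame `i` to frame `j` -/
  trans : ι → ι → M → spinGroup s.Q
  smooth_trans : ∀ i j, ContMDiffOn (𝓡 2) 𝓘(ℝ, Pinor →L[ℝ] Pinor) ∞
    (fun x ↦ s.act (trans i j x)) (domain i ∩ domain j)
  cocycle : ∀ i j k, ∀ x ∈ domain i ∩ domain j ∩ domain k,
    trans j k x * trans i j x = trans i k x
  covers : ∀ i j, ∀ x ∈ domain i ∩ domain j, ∀ v : TangentSpace (𝓡 2) x,
    CliffordAlgebra.ι s.Q (g.components (fun a ↦ frame j a x) v) =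
      trans i j x * CliffordAlgebra.ι s.Q (g.components (fun a ↦ frame i a x) v) *
        ((trans i j x)⁻¹ : spinGroup s.Q)

namespace SpinStructure

variable {s : Sig} {M : Type*} [TopologicalSpace M] [ChartedSpace Plane M]
  [IsManifold (𝓡 2) ∞ M] {g : SurfaceMetric s M} {ι : Type*} (P : SpinStructure g ι)

theorem trans_self (i : ι) (x : M) (hx : x ∈ P.domain i) : P.trans i i x = 1 := by
  have h := P.cocycle i i i x ⟨⟨hx, hx⟩, hx⟩
  simpa using h

/-- The vector bundle with fibre the pinor module glued by the spin cocycle, that is,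
the bundle associated to the spin structure and the pinor module. -/
def core : VectorBundleCore ℝ M Pinor ι where
  baseSet := P.domain
  isOpen_baseSet := P.isOpen_domain
  indexAt := P.indexAt
  mem_baseSet_at := P.mem_domain_indexAt
  coordChange i j x := s.act (P.trans i j x)
  coordChange_self i x hx v := by
    rw [P.trans_self i x hx]
    exact s.act_one v
  continuousOn_coordChange i j := (P.smooth_trans i j).continuousOn
  coordChange_comp i j k x hx v := by
    rw [← s.act_mul, ← P.cocycle i j k x hx]
    rfl

/-- The spinor bundle. An element of the fibre at `x` is given by its components in the frame
with index `P.indexAt x`. -/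
abbrev Spinor : M → Type := P.core.Fiber

instance (x : M) : IsTopologicalAddGroup (P.core.Fiber x) :=
  inferInstanceAs (IsTopologicalAddGroup Pinor)

instance (x : M) : ContinuousSMul ℝ (P.core.Fiber x) :=
  inferInstanceAs (ContinuousSMul ℝ Pinor)

instance (x : M) : T2Space (P.core.Fiber x) :=
  inferInstanceAs (T2Space Pinor)

instance (x : M) : FiniteDimensional ℝ (P.core.Fiber x) :=
  inferInstanceAs (FiniteDimensional ℝ Pinor)

instance : P.core.IsContMDiff (𝓡 2) ∞ := ⟨P.smooth_trans⟩

/-- The preferred orthonormal basis of `T_x M`. -/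
def basisAt (x : M) (a : Fin 2) : TangentSpace (𝓡 2) x := P.frame (P.indexAt x) a x

/-- Clifford multiplication `X · ε`. -/
def clifford (x : M) : TangentSpace (𝓡 2) x →ₗ[ℝ] P.Spinor x →ₗ[ℝ] P.Spinor x :=
  (Matrix.toLin' : Matrix (Fin 2) (Fin 2) ℝ ≃ₗ[ℝ] Pinor →ₗ[ℝ] Pinor).toLinearMap ∘ₗ
    s.gammaVec ∘ₗ g.components (P.basisAt x)

/-- The action `A · ε = (1/4) A_{ab} Γ^{ab} ε`, with `A_{ab} = g(e_a, A e_b)`, of a skew-symmetric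
endomorphism `A` of `T_x M` on spinors. -/
def soAct (x : M) (A : TangentSpace (𝓡 2) x →ₗ[ℝ] TangentSpace (𝓡 2) x) :
    P.Spinor x →ₗ[ℝ] P.Spinor x :=
  (Matrix.toLin' ((1 / 4 : ℝ) • ∑ a, ∑ b,
    g.inner x (P.basisAt x a) (A (P.basisAt x b)) • s.gammaUpper a b) : Pinor →ₗ[ℝ] Pinor)

/-- The Hodge star on vectors, `*X = g(X, e₀) e₁ - g(X, e₁) e₀`; equivalently
`X ∧ *Y = g(X, Y) e₀ ∧ e₁`. -/
def hodge (x : M) : TangentSpace (𝓡 2) x →ₗ[ℝ] TangentSpace (𝓡 2) x :=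
  (g.inner x (P.basisAt x 0)).toLinearMap.smulRight (P.basisAt x 1) -
    (g.inner x (P.basisAt x 1)).toLinearMap.smulRight (P.basisAt x 0)

/-- The components `(1/4) ω_{ab}(X) Γ^{ab} ε` of the spin connection in the frame with index
`P.indexAt x`, where `ω_{ab}(X) = g(e_a, ∇_X e_b)`. -/
def connectionForm (x : M) : TangentSpace (𝓡 2) x →ₗ[ℝ] P.Spinor x →ₗ[ℝ] P.Spinor x :=
  (Matrix.toLin' : Matrix (Fin 2) (Fin 2) ℝ ≃ₗ[ℝ] Pinor →ₗ[ℝ] Pinor).toLinearMap ∘ₗ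
    ∑ a, ∑ b, ((g.inner x (P.basisAt x a)).toLinearMap ∘ₗ
      (g.leviCivita (P.frame (P.indexAt x) b) x).toLinearMap).smulRight
        ((1 / 4 : ℝ) • s.gammaUpper a b)

/-- The components of a spinor field in the frame with index `P.indexAt x`. -/
def localRep (x : M) (ψ : ∀ y, P.Spinor y) (y : M) : Pinor :=
  P.core.coordChange (P.indexAt y) (P.indexAt x) y (ψ y)

/-- The derivative at `x` of the components of a spinor field in the frame with index
`P.indexAt x`. -/
def localDeriv (x : M) (ψ : ∀ y, P.Spinor y) : TangentSpace (𝓡 2) x →L[ℝ] P.Spinor x :=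
  mvfderiv (𝓡 2) (P.localRep x ψ) x

/-- A linear map `X ↦ f(X) ∈ End(S_x)`, as a continuous bilinear map with the argument order
`(ε, X) ↦ f(X) ε` used for connections. -/
def toForm (x : M) (f : TangentSpace (𝓡 2) x →ₗ[ℝ] P.Spinor x →ₗ[ℝ] P.Spinor x) :
    P.Spinor x →L[ℝ] TangentSpace (𝓡 2) x →L[ℝ] P.Spinor x :=
  haveI : T2Space (TangentSpace (𝓡 2) x) := inferInstanceAs (T2Space Plane)
  haveI : FiniteDimensional ℝ (TangentSpace (𝓡 2) x) := inferInstanceAs (FiniteDimensional ℝ Plane)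
  f.flip.toContinuousBilinearMap

@[simp]
theorem toForm_apply (x : M) (f : TangentSpace (𝓡 2) x →ₗ[ℝ] P.Spinor x →ₗ[ℝ] P.Spinor x)
    (e : P.Spinor x) (v : TangentSpace (𝓡 2) x) : P.toForm x f e v = f v e := rfl

theorem localRep_add (x : M) (ψ φ : ∀ y, P.Spinor y) :
    P.localRep x (ψ + φ) = P.localRep x ψ + P.localRep x φ := by
  ext1 y
  exact map_add (P.core.coordChange (P.indexAt y) (P.indexAt x) y) (ψ y) (φ y)

theorem localRep_smul (x : M) (f : M → ℝ) (ψ : ∀ y, P.Spinor y) :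
    P.localRep x (f • ψ) = f • P.localRep x ψ := by
  ext1 y
  exact map_smul (P.core.coordChange (P.indexAt y) (P.indexAt x) y) (f y) (ψ y)

theorem localRep_self (x : M) (ψ : ∀ y, P.Spinor y) : P.localRep x ψ x = ψ x :=
  P.core.coordChange_self _ x (P.mem_domain_indexAt x) (ψ x)

theorem mdifferentiableAt_localRep {x : M} {ψ : ∀ y, P.Spinor y}
    (h : MDifferentiableAt (𝓡 2) ((𝓡 2).prod 𝓘(ℝ, Pinor))
      (fun y ↦ TotalSpace.mk' Pinor y (ψ y)) x) :
    MDifferentiableAt (𝓡 2) 𝓘(ℝ, Pinor) (P.localRep x ψ) x :=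
  (mdifferentiableAt_section (IB := 𝓡 2) (F := Pinor) (E := P.Spinor) ψ).1 h

/-- The lift of the Levi-Civita connection to the spinor bundle: in a local frame,
`∇_X ψ = dψ(X) + (1/4) ω_{ab}(X) Γ^{ab} ψ`. -/
def nabla : CovariantDerivative (𝓡 2) Pinor P.Spinor where
  toFun ψ x := P.localDeriv x ψ + P.toForm x (P.connectionForm x) (ψ x)
  isCovariantDerivativeOnUniv :=
    { add := by
        intro ψ φ x hψ hφ _
        have h : P.localDeriv x (ψ + φ) = P.localDeriv x ψ + P.localDeriv x φ := by
          unfold localDeriv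
          rw [localRep_add]
          exact mvfderiv_add (P.mdifferentiableAt_localRep hψ) (P.mdifferentiableAt_localRep hφ)
        rw [h, Pi.add_apply, map_add]
        abel
      leibniz := by
        intro ψ f x hψ hf _
        have h : P.localDeriv x (f • ψ) =
            f x • P.localDeriv x ψ + (mvfderiv (𝓡 2) f x).smulRight (ψ x) := by
          unfold localDeriv
          rw [localRep_smul]
          refine (mvfderiv_smul hf (P.mdifferentiableAt_localRep hψ)).trans ?_
          rw [localRep_self]
          rfl
        rw [h, Pi.smul_apply', map_smul, smul_add]
        abel }

/-! ### Dirac current, Lie derivatives and admissible connections -/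

/-- The Dirac current `κ(ε, ε')` of the bilinear form `B`, defined by
`g(κ(ε, ε'), X) = B(ε, X · ε')`; see `inner_diracCurrent`. -/
def diracCurrent (B : LinearMap.BilinForm ℝ Pinor) (x : M) (e : P.Spinor x) :
    P.Spinor x →ₗ[ℝ] TangentSpace (𝓡 2) x :=
  haveI : T2Space (TangentSpace (𝓡 2) x) := inferInstanceAs (T2Space Plane)
  haveI : FiniteDimensional ℝ (TangentSpace (𝓡 2) x) := inferInstanceAs (FiniteDimensional ℝ Plane)
  (g.sharp x).toLinearMap ∘ₗ
    (LinearMap.toContinuousLinearMap :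
      (TangentSpace (𝓡 2) x →ₗ[ℝ] ℝ) ≃ₗ[ℝ] (TangentSpace (𝓡 2) x →L[ℝ] ℝ)).toLinearMap ∘ₗ
    (P.clifford x).flip.compr₂ (B e)

theorem inner_diracCurrent (B : LinearMap.BilinForm ℝ Pinor) (x : M) (e e' : P.Spinor x)
    (v : TangentSpace (𝓡 2) x) :
    g.inner x (P.diracCurrent B x e e') v = B e (P.clifford x v e') :=
  g.inner_sharp x _ v

/-- The one-form `β` with values in the endomorphisms of the spinor bundle (evaluated as
`β x ε X`, which is `β(X)ε`): `b X · ε` if `ς_B = -1` and `b (*X) · ε` if `ς_B = 1`. -/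
def beta (symB : ℤˣ) (b : M → ℝ) (x : M) :
    P.Spinor x →L[ℝ] TangentSpace (𝓡 2) x →L[ℝ] P.Spinor x :=
  P.toForm x (b x • (P.clifford x ∘ₗ if symB = 1 then P.hodge x else LinearMap.id))

/-- Smooth vector fields. -/
def SmoothVF (X : ∀ x : M, TangentSpace (𝓡 2) x) : Prop :=
  ContMDiff (𝓡 2) ((𝓡 2).prod 𝓘(ℝ, Plane)) ∞ (fun x ↦ TotalSpace.mk' Plane x (X x))

/-- Smooth sections of the spinor bundle. -/
def SmoothSpinor (ψ : ∀ x, P.Spinor x) : Prop :=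
  ContMDiff (𝓡 2) ((𝓡 2).prod 𝓘(ℝ, Pinor)) ∞ (fun x ↦ TotalSpace.mk' Pinor x (ψ x))

/-- The connection `D = ∇ - β`. -/
def connection (β : ∀ x, P.Spinor x →L[ℝ] TangentSpace (𝓡 2) x →L[ℝ] P.Spinor x) :
    CovariantDerivative (𝓡 2) Pinor P.Spinor :=
  P.nabla.addOneForm fun x ↦ -β x

/-- The Killing spinors: smooth spinor fields parallel for `D = ∇ - β`. -/
def killingSpinors (β : ∀ x, P.Spinor x →L[ℝ] TangentSpace (𝓡 2) x →L[ℝ] P.Spinor x) :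
    Set (∀ x, P.Spinor x) :=
  {ψ | P.SmoothSpinor ψ ∧ P.connection β ψ = 0}

/-- The spinorial (Kosmann) Lie derivative `ℒ_Y ψ = ∇_Y ψ - (∇Y) · ψ`. -/
def lieSpinor (Y : ∀ x : M, TangentSpace (𝓡 2) x) (ψ : ∀ x, P.Spinor x) (x : M) : P.Spinor x :=
  P.nabla ψ x (Y x) - P.soAct x (g.leviCivita Y x).toLinearMap (ψ x)

/-- The Lie derivative of `β`, applied to a vector field `X` and a spinor field `ζ`:
`(ℒ_Y β)(X)ζ = ℒ_Y(β(X)ζ) - β([Y, X])ζ - β(X)(ℒ_Y ζ)`. -/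
def lieForm (β : ∀ x, P.Spinor x →L[ℝ] TangentSpace (𝓡 2) x →L[ℝ] P.Spinor x)
    (Y X : ∀ x : M, TangentSpace (𝓡 2) x) (ζ : ∀ x, P.Spinor x) (x : M) : P.Spinor x :=
  P.lieSpinor Y (fun y ↦ β y (ζ y) (X y)) x - β x (ζ x) (mlieBracket (𝓡 2) Y X x)
    - β x (P.lieSpinor Y ζ x) (X x)

/-- The endomorphism `γ(ε, ε)` of `T_x M`, given by `γ(ε, ε)X = -2 κ(ε, β(X)ε)`. -/
def gammaEnd (B : LinearMap.BilinForm ℝ Pinor)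
    (β : ∀ x, P.Spinor x →L[ℝ] TangentSpace (𝓡 2) x →L[ℝ] P.Spinor x) (x : M) (e : P.Spinor x) :
    TangentSpace (𝓡 2) x →ₗ[ℝ] TangentSpace (𝓡 2) x :=
  (-2 : ℝ) • (P.diracCurrent B x e ∘ₗ (β x e).toLinearMap)

/-- The connection `D = ∇ - β` is admissible for the Dirac current of `B`. -/
structure IsAdmissible (B : LinearMap.BilinForm ℝ Pinor)
    (β : ∀ x, P.Spinor x →L[ℝ] TangentSpace (𝓡 2) x →L[ℝ] P.Spinor x) : Prop where
  /-- `β` is a smooth one-form with values in the endomorphisms of the spinor bundle -/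
  smooth : ∀ X ζ, SmoothVF X → P.SmoothSpinor ζ → P.SmoothSpinor fun x ↦ β x (ζ x) (X x)
  /-- `γ(ε, ε)` is skew-symmetric -/
  skew : ∀ x (e : P.Spinor x) (v w : TangentSpace (𝓡 2) x),
    g.inner x (P.gammaEnd B β x e v) w = -g.inner x v (P.gammaEnd B β x e w)
  /-- `β(κ_ε)ε + γ(ε, ε) · ε = 0` -/
  cocycle : ∀ x (e : P.Spinor x),
    β x e (P.diracCurrent B x e e) + P.soAct x (P.gammaEnd B β x e) e = 0
  /-- `ℒ_{κ_ε} β = 0` for every Killing spinor `ε` -/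
  invariant : ∀ ε ∈ P.killingSpinors β, ∀ X ζ, SmoothVF X → P.SmoothSpinor ζ →
    P.lieForm β (fun x ↦ P.diracCurrent B x (ε x) (ε x)) X ζ = 0

end SpinStructure

end

/-!
In two dimensions everything is controlled by the pair `T`, `Γ_*`. Put `T = 1` if `ς_B = -1` and
`T = Γ_*` if `ς_B = 1`. Since `*X · ε = X · Γ_* ε`, in both cases `β(X)ε = b X · T ε`; and an
admissible form is `B(ε, ε') = l area(ε, T ε')` for a constant `l`, where `area` is the standard
symplectic form on `ℝ²` (`Sig.IsAdmissible.exists_eq_area`). An element of the spin group acts as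
`a + d Γ_*` with determinant `1`, so it commutes with `T` and preserves `area`; hence these
descriptions hold in the components with respect to any frame of the spin structure
(`SpinStructure.change_beta`, `SpinStructure.comp_diracCurrent`).

The form `B(ε, w · v · T ε)` is skew in `v` and `w`, because its symmetric part is a multiple of
`B(ε, T ε) = ± l area(ε, ε) = 0`. This is the skew-symmetry of `γ(ε, ε)`, and the cocycle condition
is then the Fierz identity `Sig.twistedClifford_current`.

Let `ε` be a Killing spinor. Then `∇_v κ_ε` is `2 κ(ε, β(v)ε)`, so it is skew in `v`, that is, `κ_ε`
is a Killing field (`SpinStructure.comp_leviCivita_diracField`). Its Kosmann derivative obeys the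
Leibniz rule for Clifford multiplication and commutes with `T`, and so
`(ℒ_{κ_ε} β)(X)ζ = db(κ_ε) X · T ζ`. It remains to see that `db(κ_ε) = 0`. The function
`u = area(ε, Γ_* ε)` satisfies `du(v) = 2 b area(ε, Γ_* (v · T ε))`, and the linear form
`θ(v) = area(ε, Γ_* (v · T ε))` is closed, for the same reason that the divergence of a Killing field
vanishes: `± l θ` is the metric dual of `*κ_ε`. So `d²u = 0` reads `db ∧ θ = 0`, and therefore
`db(κ_ε) = 0` (`SpinStructure.mvfderiv_mul_cubic`, `SpinStructure.mvfderiv_diracField`). This avoids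
the curvature of `D`; `d²u = 0` enters through `mvfderiv_mlieBracket`, on an orthonormal frame.
-/

noncomputable section

/-! ### Algebra of the pinor module -/

namespace Sig

variable (s : Sig)

theorem gammaStar_mul_self : s.gammaStar * s.gammaStar = -(s.eta 0 * s.eta 1) • 1 := by
  cases s <;> ext i j <;> fin_cases i <;> fin_cases j <;>
    simp [gammaStar, gamma, eta, Matrix.mul_apply, Fin.sum_univ_two]

theorem gammaVec_mul_gammaVec (v w : Fin 2 → ℝ) :
    s.gammaVec v * s.gammaVec w = (s.eta 0 * v 0 * w 0 + s.eta 1 * v 1 * w 1) • 1 +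
      (v 0 * w 1 - v 1 * w 0) • s.gammaStar := by
  cases s <;> ext i j <;> fin_cases i <;> fin_cases j <;>
    simp [gammaVec_apply, gammaStar, gamma, eta, Matrix.mul_apply, Fin.sum_univ_two] <;> ring

/-- An even element of the Clifford algebra acts on pinors as `a + d Γ_*`, and its Clifford
conjugate acts as `a - d Γ_*`. -/
theorem exists_rep_even {c : CliffordAlgebra s.Q} (hc : c ∈ CliffordAlgebra.evenOdd s.Q 0) :
    ∃ a d : ℝ, s.rep c = a • 1 + d • s.gammaStar ∧ s.rep (star c) = a • 1 - d • s.gammaStar := by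
  induction c, hc using CliffordAlgebra.even_induction with
  | algebraMap r =>
    refine ⟨r, 0, ?_, ?_⟩
    · simp [Algebra.algebraMap_eq_smul_one]
    · simp [CliffordAlgebra.star_def, Algebra.algebraMap_eq_smul_one]
  | add x y hx hy ihx ihy =>
    obtain ⟨a, d, h1, h2⟩ := ihx
    obtain ⟨a', d', h1', h2'⟩ := ihy
    refine ⟨a + a', d + d', ?_, ?_⟩
    · rw [map_add, h1, h1']; module
    · rw [star_add, map_add, h2, h2']; module
  | ι_mul_ι_mul v w x hx ih =>
    obtain ⟨a, d, h1, h2⟩ := ih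
    have hv : ∀ u : Fin 2 → ℝ, s.rep (CliffordAlgebra.ι s.Q u) = s.gammaVec u := fun u ↦ by
      simp [rep]
    refine ⟨(s.eta 0 * v 0 * w 0 + s.eta 1 * v 1 * w 1) * a
        - s.eta 0 * s.eta 1 * (v 0 * w 1 - v 1 * w 0) * d,
      (s.eta 0 * v 0 * w 0 + s.eta 1 * v 1 * w 1) * d + (v 0 * w 1 - v 1 * w 0) * a, ?_, ?_⟩
    · rw [map_mul, map_mul, hv, hv, gammaVec_mul_gammaVec, h1]
      simp only [add_mul, mul_add, smul_mul_assoc, mul_smul_comm, one_mul, mul_one,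
        gammaStar_mul_self]
      module
    · rw [star_mul, star_mul, CliffordAlgebra.star_ι, CliffordAlgebra.star_ι, neg_mul_neg,
        map_mul, map_mul, hv, hv, gammaVec_mul_gammaVec, h2]
      simp only [sub_mul, mul_add, smul_mul_assoc, mul_smul_comm, one_mul, mul_one,
        gammaStar_mul_self]
      module

/-- An element of the spin group acts on pinors as `a + d Γ_*` with determinant
`a² + η₀ η₁ d² = 1`. -/
theorem exists_act_spin (c : spinGroup s.Q) :
    ∃ a d : ℝ, (∀ e : Pinor, s.act c e = a • e + d • (s.gammaStar *ᵥ e)) ∧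
      a ^ 2 + s.eta 0 * s.eta 1 * d ^ 2 = 1 := by
  obtain ⟨a, d, h1, h2⟩ := s.exists_rep_even (spinGroup.mem_even c.2)
  refine ⟨a, d, fun e ↦ ?_, ?_⟩
  · simp [act, h1]
  · have h : s.rep (star (c : CliffordAlgebra s.Q) * c) = 1 := by
      rw [spinGroup.star_mul_self_of_mem c.2, map_one]
    rw [map_mul, h1, h2] at h
    simp only [sub_mul, mul_add, smul_mul_assoc, mul_smul_comm, one_mul, mul_one,
      gammaStar_mul_self] at h
    have h00 := congrFun (congrFun h 0) 0
    simp at h00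
    linarith

/-- The matrix `T` for which `β(X)ε = b X · T ε`: the identity if `ς_B = -1`, and `Γ_*` if
`ς_B = 1`, since `*X · ε = X · Γ_* ε`. -/
def twist (symB : ℤˣ) : Matrix (Fin 2) (Fin 2) ℝ :=
  if symB = 1 then s.gammaStar else 1

/-- The area form `e₀ e'₁ - e₁ e'₀` on pinors. -/
def area : LinearMap.BilinForm ℝ Pinor :=
  LinearMap.mk₂ ℝ (fun e e' ↦ e 0 * e' 1 - e 1 * e' 0)
    (fun _ _ _ ↦ by simp only [Pi.add_apply]; ring)
    (fun _ _ _ ↦ by simp only [Pi.smul_apply, smul_eq_mul]; ring)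
    (fun _ _ _ ↦ by simp only [Pi.add_apply]; ring)
    (fun _ _ _ ↦ by simp only [Pi.smul_apply, smul_eq_mul]; ring)

theorem area_apply (e e' : Pinor) : area e e' = e 0 * e' 1 - e 1 * e' 0 := rfl

/-- Up to a factor, an admissible bilinear form is the area form `J`, if it is skew, and
`J(-, Γ_* -)`, if it is symmetric. -/
theorem IsAdmissible.exists_eq_area {s : Sig} {B : LinearMap.BilinForm ℝ Pinor} {symB typeB : ℤˣ}
    (hB : s.IsAdmissible B symB typeB) :
    ∃ l : ℝ, ∀ e e' : Pinor, B e e' = l * area e (s.twist symB *ᵥ e') := by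
  have key : ∀ e e' : Pinor, B e e' =
      e 0 * e' 0 * B ![1, 0] ![1, 0] + e 0 * e' 1 * B ![1, 0] ![0, 1] +
      e 1 * e' 0 * B ![0, 1] ![1, 0] + e 1 * e' 1 * B ![0, 1] ![0, 1] := by
    intro e e'
    have h : ∀ e : Pinor, e = e 0 • ![1, 0] + e 1 • ![0, 1] := by
      intro e
      ext i
      fin_cases i <;> simp
    conv_lhs => rw [h e, h e']
    simp only [map_add, map_smul, LinearMap.add_apply, LinearMap.smul_apply, smul_eq_mul]
    ring
  have s1 := hB.symmetry ![1, 0] ![1, 0]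
  have s2 := hB.symmetry ![1, 0] ![0, 1]
  have s3 := hB.symmetry ![0, 1] ![0, 1]
  have t1 := hB.cliffordType ![1, 0] ![1, 0] ![1, 0]
  have t2 := hB.cliffordType ![1, 0] ![1, 0] ![0, 1]
  have t3 := hB.cliffordType ![1, 0] ![0, 1] ![1, 0]
  have t4 := hB.cliffordType ![1, 0] ![0, 1] ![0, 1]
  have t5 := hB.cliffordType ![0, 1] ![1, 0] ![1, 0]
  have t6 := hB.cliffordType ![0, 1] ![1, 0] ![0, 1]
  have t7 := hB.cliffordType ![0, 1] ![0, 1] ![1, 0]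
  have t8 := hB.cliffordType ![0, 1] ![0, 1] ![0, 1]
  -- linear equations for the four coefficients of `B` in the standard basis
  simp only [key (_ *ᵥ _), key _ (_ *ᵥ _)] at t1 t2 t3 t4 t5 t6 t7 t8
  generalize B ![1, 0] ![1, 0] = p at *
  generalize B ![1, 0] ![0, 1] = q at *
  generalize B ![0, 1] ![1, 0] = r at *
  generalize B ![0, 1] ![0, 1] = t at *
  refine ⟨if symB = 1 then -(p + q) else q, fun e e' ↦ ?_⟩
  rw [key]
  rcases Int.units_eq_one_or symB with rfl | rfl <;>
    rcases Int.units_eq_one_or typeB with rfl | rfl <;> cases s <;>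
    simp [gammaVec_apply, gamma] at s1 s2 s3 t1 t2 t3 t4 t5 t6 t7 t8 <;>
    simp [area_apply, twist, gammaStar, gamma, dotProduct, Fin.sum_univ_two] <;>
    clear key hB <;> grind

/-- The map `c ↦ (η₀ c¹, -η₁ c⁰)` on components of vectors, which spans `𝔰𝔬(V)`. -/
def rot : (Fin 2 → ℝ) →ₗ[ℝ] Fin 2 → ℝ where
  toFun c := ![s.eta 0 * c 1, -(s.eta 1 * c 0)]
  map_add' c d := by ext a; fin_cases a <;> simp <;> ring
  map_smul' r c := by ext a; fin_cases a <;> simp <;> ring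

@[simp]
theorem rot_zero (c : Fin 2 → ℝ) : s.rot c 0 = s.eta 0 * c 1 := rfl

@[simp]
theorem rot_one (c : Fin 2 → ℝ) : s.rot c 1 = -(s.eta 1 * c 0) := rfl

/-- The map `(v, ε) ↦ v · T ε`. -/
def twistedClifford (symB : ℤˣ) : (Fin 2 → ℝ) →ₗ[ℝ] Pinor →ₗ[ℝ] Pinor :=
  LinearMap.mk₂ ℝ (fun c e ↦ s.gammaVec c *ᵥ (s.twist symB *ᵥ e))
    (fun _ _ _ ↦ by simp only [map_add, Matrix.add_mulVec])
    (fun _ _ _ ↦ by simp only [map_smul, Matrix.smul_mulVec])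
    (fun _ _ _ ↦ by simp only [Matrix.mulVec_add])
    (fun _ _ _ ↦ by simp only [Matrix.mulVec_smul])

theorem twistedClifford_apply (symB : ℤˣ) (c : Fin 2 → ℝ) (e : Pinor) :
    s.twistedClifford symB c e = s.gammaVec c *ᵥ (s.twist symB *ᵥ e) := rfl

/-- The components `η_a B(ε, Γ_a ε')` of the Dirac current. -/
def current (B : LinearMap.BilinForm ℝ Pinor) : Pinor →ₗ[ℝ] Pinor →ₗ[ℝ] Fin 2 → ℝ :=
  LinearMap.mk₂ ℝ (fun e e' a ↦ s.eta a * B e (s.gamma a *ᵥ e'))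
    (fun _ _ _ ↦ by ext; simp [mul_add])
    (fun _ _ _ ↦ by ext; simp; ring)
    (fun _ _ _ ↦ by ext; simp only [Matrix.mulVec_add, map_add, mul_add, Pi.add_apply])
    (fun _ _ _ ↦ by
      ext; simp only [Matrix.mulVec_smul, map_smul, smul_eq_mul, Pi.smul_apply]; ring)

theorem current_apply (B : LinearMap.BilinForm ℝ Pinor) (e e' : Pinor) (a : Fin 2) :
    s.current B e e' a = s.eta a * B e (s.gamma a *ᵥ e') := rfl

/-- The form `area(ε, Γ_* ε')`. -/
def starForm : LinearMap.BilinForm ℝ Pinor :=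
  area.compl₂ (Matrix.toLin' s.gammaStar)

theorem starForm_apply (e e' : Pinor) : s.starForm e e' = area e (s.gammaStar *ᵥ e') := rfl

/-- The form `area(ε, Γ_* (c · T ε'))`. -/
def cubic (symB : ℤˣ) (c : Fin 2 → ℝ) : LinearMap.BilinForm ℝ Pinor :=
  s.starForm.compl₂ (s.twistedClifford symB c)

theorem cubic_apply (symB : ℤˣ) (c : Fin 2 → ℝ) (e e' : Pinor) :
    s.cubic symB c e e' = s.starForm e (s.twistedClifford symB c e') := rfl

/-- Infinitesimal equivariance of `(v, ε) ↦ v · T ε` under the spin group. -/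
theorem gammaStar_twistedClifford (symB : ℤˣ) (c : Fin 2 → ℝ) (e : Pinor) :
    s.gammaStar *ᵥ s.twistedClifford symB c e - s.twistedClifford symB c (s.gammaStar *ᵥ e) =
      (2 * s.eta 0 * s.eta 1) • s.twistedClifford symB (s.rot c) e := by
  unfold twistedClifford twist
  rcases Int.units_eq_one_or symB with rfl | rfl <;> cases s <;> ext i <;> fin_cases i <;>
    simp [rot, gammaVec_apply, gammaStar, gamma, eta, dotProduct,
      Fin.sum_univ_two] <;> ring

section Form

variable {s} {B : LinearMap.BilinForm ℝ Pinor} {symB : ℤˣ} {l : ℝ}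

/-- Infinitesimal equivariance of the Dirac current under the spin group. -/
theorem current_gammaStar (hB : ∀ e e' : Pinor, B e e' = l * area e (s.twist symB *ᵥ e'))
    (e : Pinor) :
    s.current B (s.gammaStar *ᵥ e) e + s.current B e (s.gammaStar *ᵥ e) =
      (2 * s.eta 0 * s.eta 1) • s.rot (s.current B e e) := by
  ext a
  simp only [Pi.add_apply, current_apply, Pi.smul_apply, hB]
  unfold twist
  rcases Int.units_eq_one_or symB with rfl | rfl <;> cases s <;> fin_cases a <;>
    simp [current_apply, hB, area_apply, twist, gammaStar, gamma, eta, dotProduct,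
      Fin.sum_univ_two] <;> ring

/-- The form `B(ε, w · v · T ε)` is skew in `v` and `w`: its symmetric part is a multiple of
`B(ε, T ε)`, which vanishes. -/
theorem current_twistedClifford (hB : ∀ e e' : Pinor, B e e' = l * area e (s.twist symB *ᵥ e'))
    (c : Fin 2 → ℝ) (e : Pinor) :
    s.current B e (s.twistedClifford symB c e) =
      B e (s.gammaStar *ᵥ (s.twist symB *ᵥ e)) • s.rot c := by
  ext a
  simp only [current_apply, Pi.smul_apply, hB, twistedClifford_apply]
  unfold twist
  rcases Int.units_eq_one_or symB with rfl | rfl <;> cases s <;> fin_cases a <;>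
    simp [area_apply, gammaVec_apply, gammaStar, gamma, eta, dotProduct,
      Fin.sum_univ_two] <;> ring

theorem current_twistedClifford_left (hB : ∀ e e' : Pinor, B e e' = l * area e (s.twist symB *ᵥ e'))
    (c : Fin 2 → ℝ) (e : Pinor) :
    s.current B (s.twistedClifford symB c e) e =
      B e (s.gammaStar *ᵥ (s.twist symB *ᵥ e)) • s.rot c := by
  ext a
  simp only [current_apply, Pi.smul_apply, hB, twistedClifford_apply]
  unfold twist
  rcases Int.units_eq_one_or symB with rfl | rfl <;> cases s <;> fin_cases a <;>
    simp [area_apply, gammaVec_apply, gammaStar, gamma, eta, dotProduct,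
      Fin.sum_univ_two] <;> ring

/-- The Fierz identity `κ_ε · T ε = η₀ η₁ B(ε, Γ_* T ε) Γ_* ε`. -/
theorem twistedClifford_current (hB : ∀ e e' : Pinor, B e e' = l * area e (s.twist symB *ᵥ e'))
    (e : Pinor) :
    s.twistedClifford symB (s.current B e e) e =
      (s.eta 0 * s.eta 1 * B e (s.gammaStar *ᵥ (s.twist symB *ᵥ e))) • s.gammaStar *ᵥ e := by
  ext i
  simp only [hB, twistedClifford_apply]
  unfold twist
  rcases Int.units_eq_one_or symB with rfl | rfl <;> cases s <;> fin_cases i <;>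
    simp [current_apply, hB, twist, area_apply, gammaVec_apply, gammaStar, gamma, eta,
      dotProduct, Fin.sum_univ_two] <;> ring

/-- Up to a factor, the linear form `v ↦ area(ε, Γ_* (v · T ε))` is the metric dual of `*κ_ε`. -/
theorem current_eq_cubic (hB : ∀ e e' : Pinor, B e e' = l * area e (s.twist symB *ᵥ e'))
    (e : Pinor) :
    s.current B e e 0 = (if symB = 1 then -s.eta 0 else s.eta 0) * l *
        s.cubic symB (Pi.single 1 1) e e ∧
      s.current B e e 1 = -((if symB = 1 then -s.eta 0 else s.eta 0) * l *
        s.cubic symB (Pi.single 0 1) e e) := by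
  simp only [current_apply, hB, cubic_apply, starForm_apply, twistedClifford_apply]
  unfold twist
  rcases Int.units_eq_one_or symB with rfl | rfl <;> cases s <;> constructor <;>
    simp [-mul_eq_mul_left_iff, area_apply, gammaVec_apply, gammaStar, gamma, eta, dotProduct,
      Fin.sum_univ_two] <;> ring

end Form

theorem starForm_gammaStar (e : Pinor) :
    s.starForm (s.gammaStar *ᵥ e) e + s.starForm e (s.gammaStar *ᵥ e) = 0 := by
  cases s <;>
    simp [starForm_apply, area_apply, gammaStar, gamma, dotProduct,
      Fin.sum_univ_two]

theorem starForm_symm (e e' : Pinor) : s.starForm e e' = s.starForm e' e := by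
  cases s <;>
    simp [starForm_apply, area_apply, gammaStar, gamma, dotProduct,
      Fin.sum_univ_two] <;> ring

/-- Infinitesimal equivariance of `cubic` under the spin group. -/
theorem cubic_gammaStar (symB : ℤˣ) (c : Fin 2 → ℝ) (e : Pinor) :
    s.cubic symB c (s.gammaStar *ᵥ e) e + s.cubic symB c e (s.gammaStar *ᵥ e) =
      -(2 * s.eta 0 * s.eta 1) * s.cubic symB (s.rot c) e e := by
  simp only [cubic_apply, starForm_apply, twistedClifford_apply]
  unfold twist
  rcases Int.units_eq_one_or symB with rfl | rfl <;> cases s <;>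
    simp [area_apply, gammaVec_apply, gammaStar, gamma, eta, dotProduct,
      Fin.sum_univ_two] <;> ring

/-- The derivative of `area(ε, Γ_* (v · T ε))` in the direction `w · T ε` is symmetric in `v` and `w`:
the part of `area(ε, Γ_* (v · T (w · T ε)))` that is skew in `v` and `w` is a multiple of
`area(ε, ε) = 0`, and the other term is symmetric since `starForm` is. -/
theorem cubic_twistedClifford (symB : ℤˣ) (c d : Fin 2 → ℝ) (e : Pinor) :
    s.cubic symB c (s.twistedClifford symB d e) e + s.cubic symB c e (s.twistedClifford symB d e) =
    s.cubic symB d (s.twistedClifford symB c e) e +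
      s.cubic symB d e (s.twistedClifford symB c e) := by
  simp only [cubic_apply, starForm_apply, twistedClifford_apply]
  unfold twist
  rcases Int.units_eq_one_or symB with rfl | rfl <;> cases s <;>
    simp [area_apply, gammaVec_apply, gammaStar, gamma, dotProduct,
      Fin.sum_univ_two] <;> ring

theorem gammaUpper_sum (A : Fin 2 → Fin 2 → ℝ) (hA : ∀ a b, A a b = -A b a) :
    (1 / 4 : ℝ) • ∑ a, ∑ b, A a b • s.gammaUpper a b =
      (1 / 2 * s.eta 0 * s.eta 1 * A 0 1) • s.gammaStar := by
  have h0 : A 0 0 = 0 := by linarith [hA 0 0]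
  have h1 : A 1 1 = 0 := by linarith [hA 1 1]
  have hanti : s.gamma 1 * s.gamma 0 = -s.gammaStar := by
    cases s <;> ext i j <;> fin_cases i <;> fin_cases j <;>
      simp [gammaStar, gamma]
  simp only [Fin.sum_univ_two, h0, h1, hA 1 0, gammaUpper, hanti]
  change _ = _ • (s.gamma 0 * s.gamma 1)
  simp only [gammaStar]
  module

end Sig

/-! ### Lie brackets as commutators of derivatives -/

section LieBracket

variable {E : Type*} [NormedAddCommGroup E] [NormedSpace ℝ E]
  {M : Type*} [TopologicalSpace M] [ChartedSpace E M] [IsManifold 𝓘(ℝ, E) ∞ M]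

/-- The derivative of a function along a tangent vector, computed in a chart. -/
theorem fderiv_comp_extChartAt_symm {h : M → ℝ} {x : M} {p : E}
    (hp : p ∈ (extChartAt 𝓘(ℝ, E) x).target)
    (hh : MDifferentiableAt 𝓘(ℝ, E) 𝓘(ℝ) h ((extChartAt 𝓘(ℝ, E) x).symm p))
    (ξ : TangentSpace 𝓘(ℝ, E) ((extChartAt 𝓘(ℝ, E) x).symm p)) :
    fderiv ℝ (h ∘ (extChartAt 𝓘(ℝ, E) x).symm) p
        ((mfderiv 𝓘(ℝ, E) 𝓘(ℝ, E) (extChartAt 𝓘(ℝ, E) x).symm p).inverse ξ) =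
      mvfderiv 𝓘(ℝ, E) h ((extChartAt 𝓘(ℝ, E) x).symm p) ξ := by
  have : IsManifold 𝓘(ℝ, E) 1 M := .of_le (n := ∞) (by simp)
  have hinv := isInvertible_mfderivWithin_extChartAt_symm (I := 𝓘(ℝ, E)) hp
  have hd := mdifferentiableWithinAt_extChartAt_symm (I := 𝓘(ℝ, E)) hp
  simp only [modelWithCornersSelf_coe, range_id, mfderivWithin_univ,
    mdifferentiableWithinAt_univ] at hinv hd
  have hc := mfderiv_comp p hh hd
  have hc' : fderiv ℝ (h ∘ (extChartAt 𝓘(ℝ, E) x).symm) p = _ := mfderiv_eq_fderiv.symm.trans hc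
  rw [hc']
  have := hinv.self_apply_inverse ξ
  change mfderiv 𝓘(ℝ, E) 𝓘(ℝ) h ((extChartAt 𝓘(ℝ, E) x).symm p)
    (mfderiv 𝓘(ℝ, E) 𝓘(ℝ, E) (extChartAt 𝓘(ℝ, E) x).symm p
      ((mfderiv 𝓘(ℝ, E) 𝓘(ℝ, E) (extChartAt 𝓘(ℝ, E) x).symm p).inverse ξ)) = _
  rw [this]
  rfl

/-- The derivative along a Lie bracket is the commutator of the derivatives. -/
theorem mvfderiv_mlieBracket [CompleteSpace E] {u : M → ℝ}
    {V W : ∀ y : M, TangentSpace 𝓘(ℝ, E) y} {x : M}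
    (hu : ContMDiff 𝓘(ℝ, E) 𝓘(ℝ) ∞ u)
    (hV : MDifferentiableAt 𝓘(ℝ, E) (𝓘(ℝ, E).prod 𝓘(ℝ, E)) (fun y ↦ TotalSpace.mk' E y (V y)) x)
    (hW : MDifferentiableAt 𝓘(ℝ, E) (𝓘(ℝ, E).prod 𝓘(ℝ, E)) (fun y ↦ TotalSpace.mk' E y (W y)) x)
    (hVu : MDifferentiableAt 𝓘(ℝ, E) 𝓘(ℝ) (fun y ↦ mvfderiv 𝓘(ℝ, E) u y (V y)) x)
    (hWu : MDifferentiableAt 𝓘(ℝ, E) 𝓘(ℝ) (fun y ↦ mvfderiv 𝓘(ℝ, E) u y (W y)) x) :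
    mvfderiv 𝓘(ℝ, E) u x (mlieBracket 𝓘(ℝ, E) V W x) =
      mvfderiv 𝓘(ℝ, E) (fun y ↦ mvfderiv 𝓘(ℝ, E) u y (W y)) x (V x) -
        mvfderiv 𝓘(ℝ, E) (fun y ↦ mvfderiv 𝓘(ℝ, E) u y (V y)) x (W x) := by
  have : IsManifold 𝓘(ℝ, E) 2 M := .of_le (n := ∞) (WithTop.coe_le_coe.2 le_top)
  have : IsManifold 𝓘(ℝ, E) 1 M := .of_le (n := ∞) (by simp)
  set φ := extChartAt 𝓘(ℝ, E) x with hφ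
  have hx : φ x ∈ φ.target := mem_extChartAt_target x
  have hxx : φ.symm (φ x) = x := extChartAt_to_inv x
  let pull (Z : ∀ y : M, TangentSpace 𝓘(ℝ, E) y) (p : E) : E :=
    (mfderiv 𝓘(ℝ, E) 𝓘(ℝ, E) φ.symm p).inverse (Z (φ.symm p))
  let L : E := lieBracket ℝ (pull V) (pull W) (φ x)
  have hbr : mlieBracket 𝓘(ℝ, E) V W x = (mfderiv 𝓘(ℝ, E) 𝓘(ℝ, E) φ x).inverse L := by
    rw [← mlieBracketWithin_univ, mlieBracketWithin_apply]
    simp only [modelWithCornersSelf_coe, range_id, preimage_univ, univ_inter, mpullbackWithin_univ]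
    exact congrArg _ (congrFun lieBracketWithin_univ (φ x))
  have hpull : ∀ Z : ∀ y : M, TangentSpace 𝓘(ℝ, E) y,
      MDifferentiableAt 𝓘(ℝ, E) (𝓘(ℝ, E).prod 𝓘(ℝ, E)) (fun y ↦ TotalSpace.mk' E y (Z y)) x →
      DifferentiableAt ℝ (pull Z) (φ x) := by
    intro Z hZ
    have h := (mdifferentiableWithinAt_univ.2 hZ).differentiableWithinAt_mpullbackWithin_vectorField
    simp only [modelWithCornersSelf_coe, range_id, preimage_univ, univ_inter,
      mpullbackWithin_univ] at h
    exact differentiableWithinAt_univ.1 h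
  have hucd : ContDiffAt ℝ ∞ (u ∘ φ.symm) (φ x) := by
    have h := (hu.contMDiffAt (x := φ.symm (φ x))).comp_contMDiffWithinAt (φ x)
      (contMDiffWithinAt_extChartAt_symm_range (I := 𝓘(ℝ, E)) (n := ∞) x hx)
    simp only [modelWithCornersSelf_coe, range_id, contMDiffWithinAt_univ] at h
    exact h.contDiffAt
  have hev : ∀ Z : ∀ y : M, TangentSpace 𝓘(ℝ, E) y,
      (fun p ↦ fderiv ℝ (u ∘ φ.symm) p (pull Z p)) =ᶠ[𝓝 (φ x)]
        (fun y ↦ mvfderiv 𝓘(ℝ, E) u y (Z y)) ∘ φ.symm := by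
    intro Z
    filter_upwards [extChartAt_target_mem_nhds x] with p hp
    exact fderiv_comp_extChartAt_symm hp (hu.mdifferentiableAt (by simp)) _
  have hmain := fderiv_apply_lieBracket (𝕜 := ℝ) hucd
    (by rw [minSmoothness_of_isRCLikeNormedField]; exact WithTop.coe_le_coe.2 le_top)
    (hpull W hW) (hpull V hV)
  rw [(hev V).fderiv_eq, (hev W).fderiv_eq] at hmain
  have hend : ∀ {k : M → ℝ} (Z : ∀ y : M, TangentSpace 𝓘(ℝ, E) y),
      MDifferentiableAt 𝓘(ℝ, E) 𝓘(ℝ) k x →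
      fderiv ℝ (k ∘ φ.symm) (φ x) (pull Z (φ x)) = mvfderiv 𝓘(ℝ, E) k x (Z x) := by
    intro k Z hk
    refine (fderiv_comp_extChartAt_symm hx ?_ _).trans ?_
    · rw [← hφ, hxx]; exact hk
    · rw [← hφ, hxx]
  rw [hend V hWu, hend W hVu] at hmain
  rw [← hmain, hbr]
  -- `du` is the pull-back under the chart of the derivative of the local representative
  have hφd : MDifferentiableAt 𝓘(ℝ, E) 𝓘(ℝ, E) φ x :=
    mdifferentiableAt_extChartAt (mem_chart_source E x)
  have hloc : u =ᶠ[𝓝 x] (u ∘ φ.symm) ∘ φ := by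
    filter_upwards [extChartAt_source_mem_nhds (I := 𝓘(ℝ, E)) x] with y hy
    exact congrArg u ((extChartAt 𝓘(ℝ, E) x).left_inv hy).symm
  have hc := mfderiv_comp x (hucd.differentiableAt (by simp)).mdifferentiableAt hφd
  rw [← hloc.mfderiv_eq, mfderiv_eq_fderiv] at hc
  change mfderiv 𝓘(ℝ, E) 𝓘(ℝ) u x _ = _
  rw [hc]
  exact congrArg (fderiv ℝ (u ∘ φ.symm) (φ x))
    ((isInvertible_mfderiv_extChartAt (mem_extChartAt_source x)).self_apply_inverse L)

end LieBracket

/-! ### Derivatives of bilinear expressions -/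

section Bilinear

variable {M : Type*} [TopologicalSpace M] [ChartedSpace Plane M]
  {E F G : Type*} [NormedAddCommGroup E] [NormedSpace ℝ E] [FiniteDimensional ℝ E]
  [NormedAddCommGroup F] [NormedSpace ℝ F] [FiniteDimensional ℝ F]
  [NormedAddCommGroup G] [NormedSpace ℝ G]

theorem hasMFDerivAt_bilinear (L : E →ₗ[ℝ] F →ₗ[ℝ] G) {f : M → E} {h : M → F} {x : M}
    (hf : MDifferentiableAt (𝓡 2) 𝓘(ℝ, E) f x) (hh : MDifferentiableAt (𝓡 2) 𝓘(ℝ, F) h x) :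
    HasMFDerivAt (𝓡 2) 𝓘(ℝ, G) (fun y ↦ L (f y) (h y)) x
      ((L.toContinuousBilinearMap.deriv₂ (f x, h x)).comp
        ((mvfderiv (𝓡 2) f x).prod (mvfderiv (𝓡 2) h x))) := by
  have h1 : HasMFDerivAt (𝓡 2) 𝓘(ℝ, E × F) (fun y ↦ (f y, h y)) x
      ((mvfderiv (𝓡 2) f x).prod (mvfderiv (𝓡 2) h x)) :=
    ⟨hf.hasMFDerivAt.1.prodMk hh.hasMFDerivAt.1, hf.hasMFDerivAt.2.prodMk hh.hasMFDerivAt.2⟩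
  have h2 := (L.toContinuousBilinearMap.isBoundedBilinearMap.hasFDerivAt (f x, h x)).hasMFDerivAt
  exact HasMFDerivAt.comp x (I' := 𝓘(ℝ, E × F)) (f := fun y ↦ (f y, h y)) h2 h1

theorem mdifferentiableAt_bilinear (L : E →ₗ[ℝ] F →ₗ[ℝ] G) {f : M → E} {h : M → F} {x : M}
    (hf : MDifferentiableAt (𝓡 2) 𝓘(ℝ, E) f x) (hh : MDifferentiableAt (𝓡 2) 𝓘(ℝ, F) h x) :
    MDifferentiableAt (𝓡 2) 𝓘(ℝ, G) (fun y ↦ L (f y) (h y)) x :=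
  (hasMFDerivAt_bilinear L hf hh).mdifferentiableAt

theorem mvfderiv_bilinear (L : E →ₗ[ℝ] F →ₗ[ℝ] G) {f : M → E} {h : M → F} {x : M}
    (hf : MDifferentiableAt (𝓡 2) 𝓘(ℝ, E) f x) (hh : MDifferentiableAt (𝓡 2) 𝓘(ℝ, F) h x)
    (v : TangentSpace (𝓡 2) x) :
    mvfderiv (𝓡 2) (fun y ↦ L (f y) (h y)) x v =
      L (mvfderiv (𝓡 2) f x v) (h x) + L (f x) (mvfderiv (𝓡 2) h x v) := by
  have h1 := (hasMFDerivAt_bilinear L hf hh).mfderiv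
  have h2 : mvfderiv (𝓡 2) (fun y ↦ L (f y) (h y)) x v = _ := congrArg (fun A ↦ A v) h1
  rw [h2]
  exact add_comm _ _

theorem contMDiffAt_bilinear (L : E →ₗ[ℝ] F →ₗ[ℝ] G) {f : M → E} {h : M → F} {x : M}
    {n : WithTop ℕ∞}
    (hf : ContMDiffAt (𝓡 2) 𝓘(ℝ, E) n f x) (hh : ContMDiffAt (𝓡 2) 𝓘(ℝ, F) n h x) :
    ContMDiffAt (𝓡 2) 𝓘(ℝ, G) n (fun y ↦ L (f y) (h y)) x := by
  have h2 : ContDiff ℝ n fun p : E × F ↦ L p.1 p.2 :=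
    L.toContinuousBilinearMap.isBoundedBilinearMap.contDiff
  exact h2.contMDiff.contMDiffAt.comp (I' := 𝓘(ℝ, E × F)) x (hf.prodMk_space hh)

theorem mvfderiv_congr {f h : M → G} {x : M} (hfh : f =ᶠ[𝓝 x] h) :
    mvfderiv (𝓡 2) f x = mvfderiv (𝓡 2) h x := by
  have h1 := hfh.mfderiv_eq (I := 𝓡 2) (I' := 𝓘(ℝ, G))
  unfold mvfderiv
  rw [h1]
  rfl

theorem mvfderiv_pi_apply {f : M → Fin 2 → ℝ} {x : M}
    (hf : MDifferentiableAt (𝓡 2) 𝓘(ℝ, Fin 2 → ℝ) f x) (v : TangentSpace (𝓡 2) x) (a : Fin 2) :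
    mvfderiv (𝓡 2) f x v a = mvfderiv (𝓡 2) (fun y ↦ f y a) x v := by
  have h2 := ((ContinuousLinearMap.proj (R := ℝ) (φ := fun _ : Fin 2 ↦ ℝ) a).hasFDerivAt
    (x := f x)).hasMFDerivAt
  have h3 := HasMFDerivAt.comp x (I' := 𝓘(ℝ, Fin 2 → ℝ)) (f := f) h2 hf.hasMFDerivAt
  have h4 : mvfderiv (𝓡 2) (fun y ↦ f y a) x v = _ := congrArg (fun A ↦ A v) h3.mfderiv
  rw [h4]
  rfl

end Bilinear

/-! ### The action of the spin group on pinors -/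

namespace Sig

variable (s : Sig)

theorem act_ι (v : Fin 2 → ℝ) (e : Pinor) :
    s.act (CliffordAlgebra.ι s.Q v) e = s.gammaVec v *ᵥ e := by
  simp [act, rep]

/-- An element of the spin group intertwines Clifford multiplication by `v` and by its image. -/
theorem act_conj {c : spinGroup s.Q} {v w : Fin 2 → ℝ}
    (h : CliffordAlgebra.ι s.Q w = c * CliffordAlgebra.ι s.Q v * (c⁻¹ : spinGroup s.Q))
    (e : Pinor) : s.act c (s.gammaVec v *ᵥ e) = s.gammaVec w *ᵥ s.act c e := by
  rw [← act_ι, ← act_ι, ← s.act_mul, ← s.act_mul, h, mul_assoc, ← Submonoid.coe_mul,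
    inv_mul_cancel, Submonoid.coe_one, mul_one]

theorem act_gammaStar_mulVec (c : spinGroup s.Q) (e : Pinor) :
    s.act c (s.gammaStar *ᵥ e) = s.gammaStar *ᵥ s.act c e := by
  obtain ⟨a, d, h, -⟩ := s.exists_act_spin c
  rw [h, h, Matrix.mulVec_add, Matrix.mulVec_smul, Matrix.mulVec_smul]

theorem act_twist_mulVec (symB : ℤˣ) (c : spinGroup s.Q) (e : Pinor) :
    s.act c (s.twist symB *ᵥ e) = s.twist symB *ᵥ s.act c e := by
  unfold twist
  split_ifs
  · exact s.act_gammaStar_mulVec c e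
  · simp

theorem area_act (c : spinGroup s.Q) (e e' : Pinor) :
    area (s.act c e) (s.act c e') = area e e' := by
  obtain ⟨a, d, h, h1⟩ := s.exists_act_spin c
  rw [h, h]
  cases s <;>
    simp [area_apply, gammaStar, gamma, eta, dotProduct, Fin.sum_univ_two, Matrix.vecHead,
      Matrix.vecTail] at h1 ⊢ <;>
    linear_combination (e 0 * e' 1 - e 1 * e' 0) * h1

theorem starForm_act (c : spinGroup s.Q) (e e' : Pinor) :
    s.starForm (s.act c e) (s.act c e') = s.starForm e e' := by
  rw [starForm_apply, ← s.act_gammaStar_mulVec, s.area_act]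
  rfl

end Sig

/-! ### Vectors and spinors in a fixed frame -/

namespace SpinStructure

variable {s : Sig} {M : Type*} [TopologicalSpace M] [ChartedSpace Plane M]
  [IsManifold (𝓡 2) ∞ M] {g : SurfaceMetric s M} {ι : Type*} (P : SpinStructure g ι)

/-- The domain of the preferred frame at `x`. -/
def dom (x : M) : Set M := P.domain (P.indexAt x)

/-- The components of a tangent vector at `y` in the preferred frame at `x`. -/
def comp (x y : M) : TangentSpace (𝓡 2) y →ₗ[ℝ] Fin 2 → ℝ :=
  g.components fun a ↦ P.frame (P.indexAt x) a y

/-- The change of components of spinors at `y` from the preferred frame at `y` to the one at `x`.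
For `y = x` it is the identity, and then serves to view an element of the fibre as a pinor. -/
def change (x y : M) : P.Spinor y →L[ℝ] Pinor :=
  P.core.coordChange (P.indexAt y) (P.indexAt x) y

variable {P}

theorem self_mem_dom (x : M) : x ∈ P.dom x := P.mem_domain_indexAt x

theorem dom_mem_nhds (x : M) : P.dom x ∈ 𝓝 x :=
  (P.isOpen_domain _).mem_nhds (self_mem_dom x)

theorem change_self (x : M) (e : P.Spinor x) : P.change x x e = e :=
  P.core.coordChange_self _ x (P.mem_domain_indexAt x) e

theorem comp_apply (x y : M) (v : TangentSpace (𝓡 2) y) (a : Fin 2) :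
    P.comp x y v a = s.eta a * g.inner y (P.frame (P.indexAt x) a y) v := rfl

theorem inner_frame {x y : M} (hy : y ∈ P.dom x) (a b : Fin 2) :
    g.inner y (P.frame (P.indexAt x) a y) (P.frame (P.indexAt x) b y) =
      if a = b then s.eta a else 0 :=
  P.orthonormal _ y hy a b

theorem inner_eq_comp {x y : M} (hy : y ∈ P.dom x) (v w : TangentSpace (𝓡 2) y) :
    g.inner y v w = ∑ a, s.eta a * P.comp x y v a * P.comp x y w a := by
  conv_lhs => rw [g.expand _ (inner_frame hy) w]
  rw [map_sum]
  refine Finset.sum_congr rfl fun a _ ↦ ?_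
  rw [map_smul, comp_apply, comp_apply, g.symm y w, g.symm y v, smul_eq_mul]
  linear_combination (-s.eta a * g.inner y (P.frame (P.indexAt x) a y) v *
    g.inner y (P.frame (P.indexAt x) a y) w) * s.eta_mul_self a

theorem eq_sum_comp {x y : M} (hy : y ∈ P.dom x) (v : TangentSpace (𝓡 2) y) :
    v = ∑ a, P.comp x y v a • P.frame (P.indexAt x) a y := by
  conv_lhs => rw [g.expand _ (inner_frame hy) v]
  simp only [comp_apply, g.symm y v]

theorem comp_frame {x y : M} (hy : y ∈ P.dom x) (a : Fin 2) :
    P.comp x y (P.frame (P.indexAt x) a y) = Pi.single a 1 := by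
  ext b
  rw [comp_apply, inner_frame hy]
  rcases eq_or_ne b a with rfl | h
  · simp [s.eta_mul_self]
  · simp [h]

theorem change_clifford {x y : M} (hy : y ∈ P.dom x) (v : TangentSpace (𝓡 2) y)
    (e : P.Spinor y) :
    P.change x y (P.clifford y v e) = s.gammaVec (P.comp x y v) *ᵥ P.change x y e := by
  have h := P.covers (P.indexAt y) (P.indexAt x) y ⟨P.mem_domain_indexAt y, hy⟩ v
  exact s.act_conj h e

/-- Since `Γ_*` commutes with the spin group, the identity `*v · ε = v · Γ_* ε` holds in the
components with respect to any frame. -/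
theorem change_clifford_hodge {x y : M} (hy : y ∈ P.dom x) (v : TangentSpace (𝓡 2) y)
    (e : P.Spinor y) :
    P.change x y (P.clifford y (P.hodge y v) e) =
      s.gammaVec (P.comp x y v) *ᵥ (s.gammaStar *ᵥ P.change x y e) := by
  have h : ∀ a, P.comp y y (P.hodge y v) a =
      g.inner y (P.basisAt y 0) v * P.comp y y (P.basisAt y 1) a -
        g.inner y (P.basisAt y 1) v * P.comp y y (P.basisAt y 0) a := by
    intro a
    simp [hodge, map_sub]
  have h0 := h 0
  have h1 := h 1
  simp only [basisAt, comp_frame (self_mem_dom y)] at h0 h1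
  have c0 := P.comp_apply y y v 0
  have c1 := P.comp_apply y y v 1
  have hmat : s.gammaVec (P.comp y y (P.hodge y v)) = s.gammaVec (P.comp y y v) * s.gammaStar := by
    ext i j
    cases s <;> fin_cases i <;> fin_cases j <;>
      simp [Sig.gammaStar, Sig.gammaVec_apply, Sig.gamma, Matrix.mul_apply,
        Fin.sum_univ_two, Sig.eta, h0, h1, c0, c1]
    ring
  have hc : P.clifford y (P.hodge y v) e =
      P.clifford y v (s.gammaStar *ᵥ (show Pinor from e) : Pinor) := by
    change s.gammaVec (P.comp y y (P.hodge y v)) *ᵥ (show Pinor from e) =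
      s.gammaVec (P.comp y y v) *ᵥ (s.gammaStar *ᵥ (show Pinor from e))
    rw [hmat, Matrix.mulVec_mulVec]
  exact (congrArg (P.change x y) hc).trans ((change_clifford hy v _).trans
    (congrArg _ (s.act_gammaStar_mulVec _ e)))

/-- In every frame, `β(v)ε = b v · T ε`. -/
theorem change_beta (symB : ℤˣ) (b : M → ℝ) {x y : M} (hy : y ∈ P.dom x) (e : P.Spinor y)
    (v : TangentSpace (𝓡 2) y) :
    P.change x y (P.beta symB b y e v) =
      b y • s.twistedClifford symB (P.comp x y v) (P.change x y e) := by
  rw [Sig.twistedClifford_apply]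
  rw [beta, toForm_apply]
  have h : (b y • (P.clifford y ∘ₗ if symB = 1 then P.hodge y else LinearMap.id)) v e =
      b y • P.clifford y ((if symB = 1 then P.hodge y else LinearMap.id) v) e := rfl
  rw [h, map_smul]
  unfold Sig.twist
  split_ifs
  · rw [change_clifford_hodge hy]
  · rw [LinearMap.id_apply, change_clifford hy, Matrix.one_mulVec]

end SpinStructure

/-! ### The Levi-Civita connection in a fixed frame -/

namespace SpinStructure

variable {s : Sig} {M : Type*} [TopologicalSpace M] [ChartedSpace Plane M]
  [IsManifold (𝓡 2) ∞ M] {g : SurfaceMetric s M} {ι : Type*} {P : SpinStructure g ι}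

theorem contMDiffAt_frame (x : M) (a : Fin 2) :
    ContMDiffAt (𝓡 2) ((𝓡 2).prod 𝓘(ℝ, Plane)) ∞
      (fun y ↦ TotalSpace.mk' Plane y (P.frame (P.indexAt x) a y)) x :=
  (P.smooth_frame _ a).contMDiffAt (dom_mem_nhds x)

theorem diffVF_frame (x : M) (a : Fin 2) : DiffVF (P.frame (P.indexAt x) a) x :=
  (contMDiffAt_frame x a).mdifferentiableAt (by simp)

variable (P) in
/-- The coefficient `ω₀₁(v) = g(e₀, ∇_v e₁)` of the Levi-Civita connection in the preferred frame
at `x`. -/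
def connCoeff (x : M) (v : TangentSpace (𝓡 2) x) : ℝ :=
  g.inner x (P.frame (P.indexAt x) 0 x) (g.leviCivita (P.frame (P.indexAt x) 1) x v)

theorem inner_frame_leviCivita_skew (x : M) (a b : Fin 2) (v : TangentSpace (𝓡 2) x) :
    g.inner x (P.frame (P.indexAt x) a x) (g.leviCivita (P.frame (P.indexAt x) b) x v) =
      -g.inner x (P.frame (P.indexAt x) b x) (g.leviCivita (P.frame (P.indexAt x) a) x v) := by
  have h := g.leviCivita_metric (SurfaceMetric.diffVF_extend v) (diffVF_frame (P := P) x a)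
    (diffVF_frame (P := P) x b)
  have hc : (fun y ↦ g.inner y (P.frame (P.indexAt x) a y) (P.frame (P.indexAt x) b y)) =ᶠ[𝓝 x]
      fun _ ↦ if a = b then s.eta a else 0 := by
    filter_upwards [dom_mem_nhds (P := P) x] with y hy using inner_frame hy a b
  rw [mvfderiv_congr hc, mvfderiv_const, FiberBundle.extend_apply_self] at h
  rw [g.symm x (P.frame (P.indexAt x) b x)]
  have h' : (0 : ℝ) = _ := h
  linarith

theorem contMDiffAt_comp {X : ∀ y : M, TangentSpace (𝓡 2) y} {x : M}
    (hX : ContMDiffAt (𝓡 2) ((𝓡 2).prod 𝓘(ℝ, Plane)) ∞ (fun y ↦ TotalSpace.mk' Plane y (X y)) x) :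
    ContMDiffAt (𝓡 2) 𝓘(ℝ, Fin 2 → ℝ) ∞ (fun y ↦ P.comp x y (X y)) x := by
  rw [contMDiffAt_pi_space]
  intro a
  have h := (g.smooth x).clm_bundle_apply₂ (E₃ := Bundle.Trivial M ℝ)
    (contMDiffAt_frame (P := P) x a) hX
  rw [contMDiffAt_totalSpace] at h
  exact (contMDiffAt_const (c := s.eta a)).mul h.2

theorem mdifferentiableAt_comp {X : ∀ y : M, TangentSpace (𝓡 2) y} {x : M} (hX : DiffVF X x) :
    MDifferentiableAt (𝓡 2) 𝓘(ℝ, Fin 2 → ℝ) (fun y ↦ P.comp x y (X y)) x := by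
  have h : ∀ a, MDifferentiableAt (𝓡 2) 𝓘(ℝ) (fun y ↦ P.comp x y (X y) a) x := fun a ↦
    (mdifferentiableAt_const (c := s.eta a)).mul
      (g.mdifferentiableAt_inner (diffVF_frame x a) hX)
  exact ⟨(continuousAt_pi.2 fun a ↦ (h a).continuousAt).continuousWithinAt,
    differentiableWithinAt_pi.2 fun a ↦ (h a).2⟩

/-- The Levi-Civita derivative in the preferred frame at `x`: since `𝔰𝔬(V)` is one-dimensional, the
connection form is `ω₀₁` times `rot`. -/
theorem comp_leviCivita {X : ∀ y : M, TangentSpace (𝓡 2) y} {x : M} (hX : DiffVF X x)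
    (v : TangentSpace (𝓡 2) x) :
    P.comp x x (g.leviCivita X x v) = mvfderiv (𝓡 2) (fun y ↦ P.comp x y (X y)) x v +
      P.connCoeff x v • s.rot (P.comp x x (X x)) := by
  have key : ∀ a, P.comp x x (g.leviCivita X x v) a =
      mvfderiv (𝓡 2) (fun y ↦ P.comp x y (X y) a) x v + s.eta a * ∑ b, P.comp x x (X x) b *
        g.inner x (P.frame (P.indexAt x) a x) (g.leviCivita (P.frame (P.indexAt x) b) x v) := by
    intro a
    have h := g.leviCivita_metric (SurfaceMetric.diffVF_extend v) (diffVF_frame (P := P) x a) hX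
    rw [FiberBundle.extend_apply_self] at h
    have h1 : mvfderiv (𝓡 2) (fun y ↦ P.comp x y (X y) a) x v =
        s.eta a * mvfderiv (𝓡 2) (fun y ↦ g.inner y (P.frame (P.indexAt x) a y) (X y)) x v := by
      have h2 := mvfderiv_mul (mdifferentiableAt_const (c := s.eta a))
        (g.mdifferentiableAt_inner (diffVF_frame (P := P) x a) hX)
      rw [mvfderiv_const] at h2
      have h3 := congrArg (fun A ↦ A v) h2
      refine Eq.trans ?_ (h3.trans ?_)
      · rfl
      · simp
    rw [h1, comp_apply, h]
    conv_rhs => enter [1, 2, 1]; rw [eq_sum_comp (P := P) (self_mem_dom x) (X x)]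
    rw [map_sum]
    simp only [map_smul, smul_apply, smul_eq_mul, inner_frame_leviCivita_skew x a,
      g.symm x (g.leviCivita (P.frame (P.indexAt x) a) x v), mul_neg, Finset.sum_neg_distrib]
    ring
  have h0 := inner_frame_leviCivita_skew (P := P) x 0 0 v
  have h1 := inner_frame_leviCivita_skew (P := P) x 1 1 v
  have h2 := inner_frame_leviCivita_skew (P := P) x 1 0 v
  have h0' : g.inner x (P.frame (P.indexAt x) 0 x)
    (g.leviCivita (P.frame (P.indexAt x) 0) x v) = 0 := by linarith
  have h1' : g.inner x (P.frame (P.indexAt x) 1 x)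
    (g.leviCivita (P.frame (P.indexAt x) 1) x v) = 0 := by linarith
  ext a
  rw [key, Pi.add_apply, mvfderiv_pi_apply (mdifferentiableAt_comp hX), Pi.smul_apply]
  congr 1
  rw [Fin.sum_univ_two, connCoeff]
  fin_cases a
  · simp [h0']; ring
  · simp [h1', h2]; ring

theorem change_soAct (x : M) (A : TangentSpace (𝓡 2) x →ₗ[ℝ] TangentSpace (𝓡 2) x)
    (hA : ∀ v w, g.inner x (A v) w = -g.inner x v (A w)) (e : P.Spinor x) :
    P.change x x (P.soAct x A e) =
      (1 / 2 * s.eta 0 * s.eta 1 * g.inner x (P.frame (P.indexAt x) 0 x)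
        (A (P.frame (P.indexAt x) 1 x))) • s.gammaStar *ᵥ P.change x x e := by
  rw [change_self, change_self]
  have h := s.gammaUpper_sum (fun a b ↦ g.inner x (P.basisAt x a) (A (P.basisAt x b)))
    (fun a b ↦ by rw [g.symm, hA])
  have h1 := congrArg (fun N : Matrix (Fin 2) (Fin 2) ℝ ↦ N *ᵥ (e : Pinor)) h
  refine h1.trans ?_
  exact Matrix.smul_mulVec _ _ _

theorem change_connectionForm (x : M) (v : TangentSpace (𝓡 2) x) (e : P.Spinor x) :
    P.change x x (P.connectionForm x v e) =
      (1 / 2 * s.eta 0 * s.eta 1 * P.connCoeff x v) • s.gammaStar *ᵥ P.change x x e := by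
  rw [change_self, change_self]
  have h := s.gammaUpper_sum (fun a b ↦ g.inner x (P.frame (P.indexAt x) a x)
      (g.leviCivita (P.frame (P.indexAt x) b) x v))
    (fun a b ↦ inner_frame_leviCivita_skew x a b v)
  have h1 := congrArg (fun N : Matrix (Fin 2) (Fin 2) ℝ ↦ N *ᵥ (e : Pinor)) h
  refine Eq.trans ?_ (h1.trans (Matrix.smul_mulVec _ _ _))
  have h2 : ∀ e' : Pinor, P.connectionForm x v e' = (∑ a, ∑ b,
      g.inner x (P.frame (P.indexAt x) a x) (g.leviCivita (P.frame (P.indexAt x) b) x v) •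
        (1 / 4 : ℝ) • s.gammaUpper a b) *ᵥ e' := by
    intro e'
    change Matrix.toLin' _ e' = _
    rw [Matrix.toLin'_apply]
    simp only [Fin.sum_univ_two]
    rfl
  refine (h2 e).trans ?_
  congr 1
  simp only [Finset.smul_sum, smul_comm (1 / 4 : ℝ)]

/-- The spin connection in the preferred frame at `x`. -/
theorem change_nabla (ψ : ∀ y, P.Spinor y) (x : M) (v : TangentSpace (𝓡 2) x) :
    P.change x x (P.nabla ψ x v) = mvfderiv (𝓡 2) (P.localRep x ψ) x v +
      (1 / 2 * s.eta 0 * s.eta 1 * P.connCoeff x v) • s.gammaStar *ᵥ P.localRep x ψ x := by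
  have h : P.nabla ψ x v = P.localDeriv x ψ v + P.connectionForm x v (ψ x) := rfl
  rw [h, map_add, change_connectionForm]
  congr 1
  exact change_self _ _

theorem SmoothSpinor.contMDiffAt_localRep {ψ : ∀ y, P.Spinor y} (h : P.SmoothSpinor ψ) (x : M) :
    ContMDiffAt (𝓡 2) 𝓘(ℝ, Pinor) ∞ (P.localRep x ψ) x :=
  (contMDiffAt_section (IB := 𝓡 2) (F := Pinor) (E := P.Spinor) x).1 (h x)

theorem smoothSpinor_of_localRep {ψ : ∀ y, P.Spinor y}
    (h : ∀ x, ContMDiffAt (𝓡 2) 𝓘(ℝ, Pinor) ∞ (P.localRep x ψ) x) : P.SmoothSpinor ψ :=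
  fun x ↦ (contMDiffAt_section (IB := 𝓡 2) (F := Pinor) (E := P.Spinor) x).2 (h x)

theorem SmoothSpinor.mdifferentiableAt_localRep {ψ : ∀ y, P.Spinor y} (h : P.SmoothSpinor ψ)
    (x : M) : MDifferentiableAt (𝓡 2) 𝓘(ℝ, Pinor) (P.localRep x ψ) x :=
  (h.contMDiffAt_localRep x).mdifferentiableAt (by simp)

end SpinStructure

/-! ### The one-form `β` and the Dirac current -/

namespace SpinStructure

variable {s : Sig} {M : Type*} [TopologicalSpace M] [ChartedSpace Plane M]
  [IsManifold (𝓡 2) ∞ M] {g : SurfaceMetric s M} {ι : Type*} {P : SpinStructure g ι}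
  {B : LinearMap.BilinForm ℝ Pinor} {symB : ℤˣ} {l : ℝ} {b : M → ℝ}

theorem localRep_beta (symB : ℤˣ) (b : M → ℝ) (X : ∀ y : M, TangentSpace (𝓡 2) y)
    (ζ : ∀ y, P.Spinor y) (x : M) :
    P.localRep x (fun y ↦ P.beta symB b y (ζ y) (X y)) =ᶠ[𝓝 x]
      fun y ↦ b y • s.twistedClifford symB (P.comp x y (X y)) (P.localRep x ζ y) := by
  filter_upwards [dom_mem_nhds (P := P) x] with y hy using change_beta symB b hy (ζ y) (X y)

theorem smoothSpinor_beta (hb : ContMDiff (𝓡 2) 𝓘(ℝ) ∞ b) {X : ∀ y : M, TangentSpace (𝓡 2) y}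
    {ζ : ∀ y, P.Spinor y} (hX : SmoothVF X) (hζ : P.SmoothSpinor ζ) :
    P.SmoothSpinor fun y ↦ P.beta symB b y (ζ y) (X y) :=
  smoothSpinor_of_localRep fun x ↦ ((hb x).smul (contMDiffAt_bilinear (s.twistedClifford symB)
    (contMDiffAt_comp (hX x)) (hζ.contMDiffAt_localRep x))).congr_of_eventuallyEq
      (localRep_beta symB b X ζ x)

theorem form_act (hB : ∀ e e' : Pinor, B e e' = l * Sig.area e (s.twist symB *ᵥ e'))
    (c : spinGroup s.Q) (e e' : Pinor) : B (s.act c e) (s.act c e') = B e e' := by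
  rw [hB, hB, ← s.act_twist_mulVec, s.area_act]

theorem comp_diracCurrent (hB : ∀ e e' : Pinor, B e e' = l * Sig.area e (s.twist symB *ᵥ e'))
    {x y : M} (hy : y ∈ P.dom x) (e e' : P.Spinor y) :
    P.comp x y (P.diracCurrent B y e e') = s.current B (P.change x y e) (P.change x y e') := by
  ext a
  rw [comp_apply, g.symm, inner_diracCurrent, Sig.current_apply]
  congr 1
  have h1 := P.change_clifford hy (P.frame (P.indexAt x) a y) e'
  rw [comp_frame hy] at h1
  have h2 : s.gammaVec (Pi.single a 1) = s.gamma a := by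
    rw [Sig.gammaVec_apply, Finset.sum_eq_single a] <;> simp +contextual
  rw [h2] at h1
  rw [← h1]
  exact (form_act hB _ _ _).symm

/-- An endomorphism with components a multiple of `rot` is skew-symmetric. -/
theorem inner_skew_of_comp {x : M} {A : TangentSpace (𝓡 2) x → TangentSpace (𝓡 2) x} {r : ℝ}
    (hA : ∀ v, P.comp x x (A v) = r • s.rot (P.comp x x v)) (v w : TangentSpace (𝓡 2) x) :
    g.inner x (A v) w = -g.inner x v (A w) := by
  rw [inner_eq_comp (P := P) (self_mem_dom x), inner_eq_comp (P := P) (self_mem_dom x), hA, hA]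
  simp only [Fin.sum_univ_two, Pi.smul_apply, Sig.rot_zero, Sig.rot_one, smul_eq_mul]
  linear_combination (r * P.comp x x v 1 * P.comp x x w 0) * (s.eta_mul_self 0 - s.eta_mul_self 1)
    + (r * P.comp x x v 0 * P.comp x x w 1) * (s.eta_mul_self 0 - s.eta_mul_self 1)

theorem inner_frame_of_comp {x : M} {A : TangentSpace (𝓡 2) x → TangentSpace (𝓡 2) x} {r : ℝ}
    (hA : ∀ v, P.comp x x (A v) = r • s.rot (P.comp x x v)) :
    g.inner x (P.frame (P.indexAt x) 0 x) (A (P.frame (P.indexAt x) 1 x)) = r := by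
  have h := congrFun (hA (P.frame (P.indexAt x) 1 x)) 0
  rw [comp_apply, comp_frame (self_mem_dom x)] at h
  simp at h
  have h1 := s.eta_mul_self 0
  have h2 : s.eta 0 * (s.eta 0 * g.inner x (P.frame (P.indexAt x) 0 x)
    (A (P.frame (P.indexAt x) 1 x))) = s.eta 0 * (r * s.eta 0) := by rw [h]
  linear_combination h2 + (r - g.inner x (P.frame (P.indexAt x) 0 x)
    (A (P.frame (P.indexAt x) 1 x))) * h1

theorem change_soAct_of_comp {x : M} {A : TangentSpace (𝓡 2) x →ₗ[ℝ] TangentSpace (𝓡 2) x} {r : ℝ}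
    (hA : ∀ v, P.comp x x (A v) = r • s.rot (P.comp x x v)) (e : P.Spinor x) :
    P.change x x (P.soAct x A e) =
      (1 / 2 * s.eta 0 * s.eta 1 * r) • s.gammaStar *ᵥ P.change x x e := by
  rw [change_soAct x A (inner_skew_of_comp hA), inner_frame_of_comp hA]

theorem comp_gammaEnd (hB : ∀ e e' : Pinor, B e e' = l * Sig.area e (s.twist symB *ᵥ e'))
    (x : M) (e : P.Spinor x) (v : TangentSpace (𝓡 2) x) :
    P.comp x x (P.gammaEnd B (P.beta symB b) x e v) =
      (-2 * (b x * B (P.change x x e) (s.gammaStar *ᵥ (s.twist symB *ᵥ P.change x x e)))) •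
        s.rot (P.comp x x v) := by
  have h : P.gammaEnd B (P.beta symB b) x e v =
      (-2 : ℝ) • P.diracCurrent B x e (P.beta symB b x e v) := rfl
  rw [h, map_smul, comp_diracCurrent hB (self_mem_dom x), change_beta symB b (self_mem_dom x),
    map_smul, Sig.current_twistedClifford hB]
  module

theorem cocycle_beta (hB : ∀ e e' : Pinor, B e e' = l * Sig.area e (s.twist symB *ᵥ e'))
    (x : M) (e : P.Spinor x) :
    P.beta symB b x e (P.diracCurrent B x e e) +
      P.soAct x (P.gammaEnd B (P.beta symB b) x e) e = 0 := by
  have h : P.change x x (P.beta symB b x e (P.diracCurrent B x e e) +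
      P.soAct x (P.gammaEnd B (P.beta symB b) x e) e) = 0 := by
    rw [map_add, change_beta symB b (self_mem_dom x), comp_diracCurrent hB (self_mem_dom x),
      Sig.twistedClifford_current hB, change_soAct_of_comp (comp_gammaEnd hB x e)]
    module
  exact (change_self x _).symm.trans h

/-- The Killing spinor equation in the preferred frame at `x`. -/
theorem mvfderiv_killing {ε : ∀ y, P.Spinor y} (hε : ε ∈ P.killingSpinors (P.beta symB b)) (x : M)
    (v : TangentSpace (𝓡 2) x) :
    mvfderiv (𝓡 2) (P.localRep x ε) x v =
      b x • s.twistedClifford symB (P.comp x x v) (P.localRep x ε x) -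
        (1 / 2 * s.eta 0 * s.eta 1 * P.connCoeff x v) • s.gammaStar *ᵥ P.localRep x ε x := by
  have h1 := congrArg (fun A : TangentSpace (𝓡 2) x →L[ℝ] P.Spinor x ↦ A v) (congrFun hε.2 x)
  have h2 : P.nabla ε x v + -P.beta symB b x (ε x) v = 0 := h1
  have h3 := congrArg (P.change x x) h2
  rw [map_add, map_neg, map_zero, change_nabla, change_beta symB b (self_mem_dom x)] at h3
  have h4 : P.change x x (ε x) = P.localRep x ε x := rfl
  rw [h4] at h3
  rw [eq_sub_iff_add_eq]
  exact add_neg_eq_zero.1 h3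

variable (P B) in
/-- The Dirac current `κ_ε` of a spinor field `ε`. -/
def diracField (ε : ∀ y, P.Spinor y) (y : M) : TangentSpace (𝓡 2) y :=
  P.diracCurrent B y (ε y) (ε y)

theorem comp_diracField (hB : ∀ e e' : Pinor, B e e' = l * Sig.area e (s.twist symB *ᵥ e'))
    (ε : ∀ y, P.Spinor y) (x : M) :
    (fun y ↦ P.comp x y (P.diracField B ε y)) =ᶠ[𝓝 x]
      fun y ↦ s.current B (P.localRep x ε y) (P.localRep x ε y) := by
  filter_upwards [dom_mem_nhds (P := P) x] with y hy using comp_diracCurrent hB hy _ _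

theorem diffVF_diracField (hB : ∀ e e' : Pinor, B e e' = l * Sig.area e (s.twist symB *ᵥ e'))
    {ε : ∀ y, P.Spinor y} (hε : P.SmoothSpinor ε) (x : M) : DiffVF (P.diracField B ε) x := by
  have hψ := hε.mdifferentiableAt_localRep x
  have hK := (mdifferentiableAt_bilinear (s.current B) hψ hψ).congr_of_eventuallyEq
    (comp_diracField hB ε x)
  have hKa : ∀ a, MDifferentiableAt (𝓡 2) 𝓘(ℝ) (fun y ↦ P.comp x y (P.diracField B ε y) a) x :=
    fun a ↦ ((ContinuousLinearMap.proj (R := ℝ) (φ := fun _ : Fin 2 ↦ ℝ)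
      a).differentiableAt.mdifferentiableAt).comp x (I' := 𝓘(ℝ, Fin 2 → ℝ)) hK
  have hsum := mdifferentiableAt_add_section
    ((hKa 0).smul_section (diffVF_frame (P := P) x 0))
    ((hKa 1).smul_section (diffVF_frame (P := P) x 1))
  refine hsum.congr_of_eventuallyEq ?_
  filter_upwards [dom_mem_nhds (P := P) x] with y hy
  congr 1
  exact (eq_sum_comp hy (P.diracField B ε y)).trans (Fin.sum_univ_two _)

/-- The Dirac current of a Killing spinor is a Killing vector field. -/
theorem comp_leviCivita_diracField
    (hB : ∀ e e' : Pinor, B e e' = l * Sig.area e (s.twist symB *ᵥ e')) {ε : ∀ y, P.Spinor y}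
    (hε : ε ∈ P.killingSpinors (P.beta symB b)) (x : M) (v : TangentSpace (𝓡 2) x) :
    P.comp x x (g.leviCivita (P.diracField B ε) x v) =
      (2 * (b x * B (P.localRep x ε x) (s.gammaStar *ᵥ (s.twist symB *ᵥ P.localRep x ε x)))) •
        s.rot (P.comp x x v) := by
  have hψ := hε.1.mdifferentiableAt_localRep x
  rw [comp_leviCivita (diffVF_diracField hB hε.1 x), mvfderiv_congr (comp_diracField hB ε x),
    mvfderiv_bilinear _ hψ hψ, (comp_diracField hB ε x).eq_of_nhds, mvfderiv_killing hε]
  simp only [map_sub, map_smul, LinearMap.sub_apply, LinearMap.smul_apply,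
    Sig.current_twistedClifford hB, Sig.current_twistedClifford_left hB]
  have h := Sig.current_gammaStar hB (P.localRep x ε x)
  rw [← eq_sub_iff_add_eq] at h
  rw [h]
  have h0 := s.eta_mul_self 0
  have h1 := s.eta_mul_self 1
  ext a
  simp only [Pi.add_apply, Pi.sub_apply, Pi.smul_apply, smul_eq_mul]
  linear_combination (-(P.connCoeff x v * s.rot (s.current B (P.localRep x ε x)
    (P.localRep x ε x)) a)) * (s.eta 1 * s.eta 1 * h0 + h1)

end SpinStructure

/-! ### Killing spinors and invariance of `β` -/

namespace SpinStructure

variable {s : Sig} {M : Type*} [TopologicalSpace M] [ChartedSpace Plane M]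
  [IsManifold (𝓡 2) ∞ M] {g : SurfaceMetric s M} {ι : Type*} {P : SpinStructure g ι}
  {B : LinearMap.BilinForm ℝ Pinor} {symB : ℤˣ} {l : ℝ} {b : M → ℝ}

variable (P) in
/-- The function `u = area(ε, Γ_* ε)` of a spinor field `ε`. -/
def starNorm (ε : ∀ y, P.Spinor y) (y : M) : ℝ :=
  s.starForm (P.localRep y ε y) (P.localRep y ε y)

theorem starForm_localRep (ε : ∀ y, P.Spinor y) (x y : M) :
    s.starForm (P.localRep x ε y) (P.localRep x ε y) = P.starNorm ε y := by
  rw [starNorm, localRep_self]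
  exact s.starForm_act _ _ _

theorem contMDiff_starNorm {ε : ∀ y, P.Spinor y} (hε : P.SmoothSpinor ε) :
    ContMDiff (𝓡 2) 𝓘(ℝ) ∞ (P.starNorm ε) := fun x ↦
  (contMDiffAt_bilinear s.starForm (hε.contMDiffAt_localRep x)
    (hε.contMDiffAt_localRep x)).congr_of_eventuallyEq
      (Filter.Eventually.of_forall fun y ↦ (starForm_localRep ε x y).symm)

/-- For a Killing spinor, `du(v) = 2 b area(ε, Γ_* (v · T ε))`, computed in the preferred frame at
the point itself. -/
theorem mvfderiv_starNorm_self {ε : ∀ y, P.Spinor y}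
    (hε : ε ∈ P.killingSpinors (P.beta symB b)) (y : M) (v : TangentSpace (𝓡 2) y) :
    mvfderiv (𝓡 2) (P.starNorm ε) y v =
      2 * (b y * s.cubic symB (P.comp y y v) (P.localRep y ε y) (P.localRep y ε y)) := by
  have hψ := hε.1.mdifferentiableAt_localRep y
  have h : P.starNorm ε = fun z ↦ s.starForm (P.localRep y ε z) (P.localRep y ε z) := by
    ext z
    exact (starForm_localRep ε y z).symm
  rw [h, mvfderiv_bilinear _ hψ hψ, mvfderiv_killing hε]
  simp only [map_sub, map_smul, LinearMap.sub_apply, LinearMap.smul_apply, smul_eq_mul]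
  have h1 := s.starForm_gammaStar (P.localRep y ε y)
  rw [s.starForm_symm (s.twistedClifford symB _ _), Sig.cubic_apply]
  linear_combination (-(1 / 2 * s.eta 0 * s.eta 1 * P.connCoeff y v)) * h1

/-- The formula for the derivative of `area(ε, Γ_* ε)` does not depend on the frame. -/
theorem mvfderiv_starNorm {ε : ∀ y, P.Spinor y}
    (hε : ε ∈ P.killingSpinors (P.beta symB b)) {x y : M} (hy : y ∈ P.dom x)
    (v : TangentSpace (𝓡 2) y) :
    mvfderiv (𝓡 2) (P.starNorm ε) y v =
      2 * (b y * s.cubic symB (P.comp x y v) (P.localRep x ε y) (P.localRep x ε y)) := by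
  have key : ∀ z, y ∈ P.dom z →
      b y * s.cubic symB (P.comp z y v) (P.localRep z ε y) (P.localRep z ε y) =
        s.starForm (P.change z y (ε y)) (P.change z y (P.beta symB b y (ε y) v)) := by
    intro z hz
    rw [change_beta symB b hz, map_smul]
    rfl
  rw [mvfderiv_starNorm_self hε, key x hy, key y (self_mem_dom y), change_self, change_self]
  exact congrArg _ (s.starForm_act _ _ _).symm

/-- `d²(area(ε, Γ_* ε)) = 0`, evaluated on the preferred frame at `x`. -/
theorem mvfderiv_mul_cubic (hb : ContMDiff (𝓡 2) 𝓘(ℝ) ∞ b) {ε : ∀ y, P.Spinor y}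
    (hε : ε ∈ P.killingSpinors (P.beta symB b)) (x : M) :
    mvfderiv (𝓡 2) b x (P.frame (P.indexAt x) 0 x) *
        s.cubic symB (Pi.single 1 1) (P.localRep x ε x) (P.localRep x ε x) =
      mvfderiv (𝓡 2) b x (P.frame (P.indexAt x) 1 x) *
        s.cubic symB (Pi.single 0 1) (P.localRep x ε x) (P.localRep x ε x) := by
  have hψ := hε.1.mdifferentiableAt_localRep x
  have hbx := (hb x).mdifferentiableAt (by simp)
  have hev : ∀ a, (fun y ↦ mvfderiv (𝓡 2) (P.starNorm ε) y (P.frame (P.indexAt x) a y)) =ᶠ[𝓝 x]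
      fun y ↦ LinearMap.mul ℝ ℝ (2 * b y)
        (s.cubic symB (Pi.single a 1) (P.localRep x ε y) (P.localRep x ε y)) := by
    intro a
    filter_upwards [dom_mem_nhds (P := P) x] with y hy
    rw [mvfderiv_starNorm hε hy, comp_frame hy, LinearMap.mul_apply']
    ring
  have h2b : MDifferentiableAt (𝓡 2) 𝓘(ℝ) (fun y ↦ 2 * b y) x :=
    (mdifferentiableAt_const (c := (2 : ℝ))).mul hbx
  have hdb : ∀ v, mvfderiv (𝓡 2) (fun y ↦ 2 * b y) x v = 2 * mvfderiv (𝓡 2) b x v := by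
    intro v
    have h := congrArg (fun A ↦ A v) (mvfderiv_mul (mdifferentiableAt_const (c := (2 : ℝ))) hbx)
    rw [mvfderiv_const] at h
    refine Eq.trans ?_ (h.trans ?_)
    · rfl
    · simp
  have hc : ∀ a, MDifferentiableAt (𝓡 2) 𝓘(ℝ) (fun y ↦
      s.cubic symB (Pi.single a 1) (P.localRep x ε y) (P.localRep x ε y)) x := fun a ↦
    mdifferentiableAt_bilinear _ hψ hψ
  have hd : ∀ a, MDifferentiableAt (𝓡 2) 𝓘(ℝ)
      (fun y ↦ mvfderiv (𝓡 2) (P.starNorm ε) y (P.frame (P.indexAt x) a y)) x := fun a ↦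
    (mdifferentiableAt_bilinear _ h2b (hc a)).congr_of_eventuallyEq (hev a)
  -- the components of the frame fields are constant near `x`
  have hfr : ∀ a v, P.comp x x (g.leviCivita (P.frame (P.indexAt x) a) x v) =
      P.connCoeff x v • s.rot (Pi.single a 1) := by
    intro a v
    have h : (fun y ↦ P.comp x y (P.frame (P.indexAt x) a y)) =ᶠ[𝓝 x] fun _ ↦ Pi.single a 1 := by
      filter_upwards [dom_mem_nhds (P := P) x] with y hy using comp_frame hy a
    rw [comp_leviCivita (diffVF_frame x a), mvfderiv_congr h, mvfderiv_const,
      comp_frame (self_mem_dom x)]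
    exact zero_add _
  have hbr := mvfderiv_mlieBracket (contMDiff_starNorm hε.1) (diffVF_frame (P := P) x 0)
    (diffVF_frame (P := P) x 1) (hd 0) (hd 1)
  have htf := g.leviCivita_torsion_free (diffVF_frame (P := P) x 0) (diffVF_frame (P := P) x 1)
  rw [mvfderiv_congr (hev 0), mvfderiv_congr (hev 1), mvfderiv_bilinear _ h2b (hc 0),
    mvfderiv_bilinear _ h2b (hc 1), mvfderiv_bilinear _ hψ hψ, mvfderiv_bilinear _ hψ hψ, hdb, hdb,
    mvfderiv_killing hε, mvfderiv_killing hε, mvfderiv_starNorm_self hε, ← htf, map_sub,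
    hfr, hfr, comp_frame (self_mem_dom x), comp_frame (self_mem_dom x)] at hbr
  have hsub : ∀ (r r' : ℝ) (c c' : Fin 2 → ℝ) (e : Pinor),
      s.cubic symB (r • c - r' • c') e e = r * s.cubic symB c e e - r' * s.cubic symB c' e e := by
    intro r r' c c' e
    simp [Sig.cubic_apply, map_sub, map_smul]
  rw [hsub] at hbr
  simp only [map_sub, map_smul, LinearMap.sub_apply, LinearMap.smul_apply, smul_eq_mul,
    LinearMap.mul_apply'] at hbr
  have g0 := s.cubic_gammaStar symB (Pi.single 0 1) (P.localRep x ε x)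
  have g1 := s.cubic_gammaStar symB (Pi.single 1 1) (P.localRep x ε x)
  have g2 := s.cubic_twistedClifford symB (Pi.single 0 1) (Pi.single 1 1) (P.localRep x ε x)
  have h0 := s.eta_mul_self 0
  have h1 := s.eta_mul_self 1
  linear_combination (-1 / 2) * hbr + b x ^ 2 * g2
    + (1 / 2 * b x * s.eta 0 * s.eta 1 * P.connCoeff x (P.frame (P.indexAt x) 0 x)) * g1
    - (1 / 2 * b x * s.eta 0 * s.eta 1 * P.connCoeff x (P.frame (P.indexAt x) 1 x)) * g0
    - (b x * (P.connCoeff x (P.frame (P.indexAt x) 0 x) *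
        s.cubic symB (s.rot (Pi.single 1 1)) (P.localRep x ε x) (P.localRep x ε x) -
      P.connCoeff x (P.frame (P.indexAt x) 1 x) *
        s.cubic symB (s.rot (Pi.single 0 1)) (P.localRep x ε x) (P.localRep x ε x))) *
      (s.eta 1 * s.eta 1 * h0 + h1)

/-- The Dirac current of a Killing spinor preserves `b`. -/
theorem mvfderiv_diracField (hB : ∀ e e' : Pinor, B e e' = l * Sig.area e (s.twist symB *ᵥ e'))
    (hb : ContMDiff (𝓡 2) 𝓘(ℝ) ∞ b) {ε : ∀ y, P.Spinor y}
    (hε : ε ∈ P.killingSpinors (P.beta symB b)) (x : M) :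
    mvfderiv (𝓡 2) b x (P.diracField B ε x) = 0 := by
  rw [eq_sum_comp (P := P) (self_mem_dom x) (P.diracField B ε x), Fin.sum_univ_two, map_add,
    map_smul, map_smul, congrFun (comp_diracField hB ε x).eq_of_nhds 0,
    congrFun (comp_diracField hB ε x).eq_of_nhds 1, (Sig.current_eq_cubic hB _).1,
    (Sig.current_eq_cubic hB _).2, smul_eq_mul, smul_eq_mul]
  linear_combination ((if symB = 1 then -s.eta 0 else s.eta 0) * l) * mvfderiv_mul_cubic hb hε x

/-- Along the Killing field `κ_ε` all terms of `ℒ_{κ_ε} β` cancel except the one with the derivative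
of `b`, and that derivative vanishes. -/
theorem lieForm_beta (hB : ∀ e e' : Pinor, B e e' = l * Sig.area e (s.twist symB *ᵥ e'))
    (hb : ContMDiff (𝓡 2) 𝓘(ℝ) ∞ b) {ε : ∀ y, P.Spinor y}
    (hε : ε ∈ P.killingSpinors (P.beta symB b)) {X : ∀ y : M, TangentSpace (𝓡 2) y}
    {ζ : ∀ y, P.Spinor y} (hX : SmoothVF X) (hζ : P.SmoothSpinor ζ) :
    P.lieForm (P.beta symB b) (P.diracField B ε) X ζ = 0 := by
  ext1 x
  have hXx : DiffVF X x := (hX x).mdifferentiableAt (by simp)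
  have hψ := hζ.mdifferentiableAt_localRep x
  have hbx := (hb x).mdifferentiableAt (by simp)
  have hcX := mdifferentiableAt_comp (P := P) hXx
  have hbr := g.leviCivita_torsion_free (diffVF_diracField hB hε.1 x) hXx
  have hY := comp_leviCivita_diracField hB hε x
  have hYX := comp_leviCivita (P := P) hXx (P.diracField B ε x)
  have hdb := mvfderiv_diracField hB hb hε x
  have hL : mvfderiv (𝓡 2) (P.localRep x fun y ↦ P.beta symB b y (ζ y) (X y)) x
      (P.diracField B ε x) = b x • (s.twistedClifford symB (mvfderiv (𝓡 2)
        (fun y ↦ P.comp x y (X y)) x (P.diracField B ε x)) (P.localRep x ζ x) +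
      s.twistedClifford symB (P.comp x x (X x))
        (mvfderiv (𝓡 2) (P.localRep x ζ) x (P.diracField B ε x))) := by
    have h := congrArg (fun A ↦ A (P.diracField B ε x))
      (mvfderiv_smul hbx (mdifferentiableAt_bilinear (s.twistedClifford symB) hcX hψ))
    rw [mvfderiv_congr (localRep_beta symB b X ζ x)]
    refine h.trans ?_
    rw [add_apply, smul_apply, mvfderiv_bilinear _ hcX hψ, ContinuousLinearMap.smulRight_apply, hdb,
      zero_smul, add_zero]
  have hS : ∀ e : P.Spinor x, P.change x x
      (P.soAct x (g.leviCivita (P.diracField B ε) x).toLinearMap e) = _ :=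
    change_soAct_of_comp hY
  have h : P.change x x (P.lieForm (P.beta symB b) (P.diracField B ε) X ζ x) = 0 := by
    unfold lieForm lieSpinor
    rw [← hbr]
    simp only [map_sub, sub_apply, change_nabla, hS, change_beta symB b (self_mem_dom x), hL, hYX,
      hY]
    have h0 := s.gammaStar_twistedClifford symB (P.comp x x (X x)) (P.localRep x ζ x)
    have hz : P.change x x (ζ x) = P.localRep x ζ x := rfl
    rw [sub_eq_iff_eq_add] at h0
    rw [(localRep_beta symB b X ζ x).eq_of_nhds, hz]
    generalize B (P.localRep x ε x) _ = q
    simp only [Matrix.mulVec_smul, map_add, map_smul, LinearMap.add_apply,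
      LinearMap.smul_apply, h0]
    have e0 := s.eta_mul_self 0
    have e1 := s.eta_mul_self 1
    ext i
    simp only [Pi.add_apply, Pi.sub_apply, Pi.smul_apply, smul_eq_mul, Pi.zero_apply]
    linear_combination (b x * (P.connCoeff x (P.diracField B ε x) - 2 * (b x * q)) *
      s.twistedClifford symB (s.rot (P.comp x x (X x))) (P.localRep x ζ x) i) *
        (s.eta 1 * s.eta 1 * e0 + e1)
  exact (change_self x _).symm.trans h

end SpinStructure

end

theorem proposition4p3 {s : Sig} {M : Type*} [TopologicalSpace M] [T2Space M]
    [SecondCountableTopology M] [ChartedSpace Plane M] [IsManifold (𝓡 2) ∞ M]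
    (g : SurfaceMetric s M) {ι : Type*} (P : SpinStructure g ι)
    (B : LinearMap.BilinForm ℝ Pinor) (symB typeB : ℤˣ) (hB : s.IsAdmissible B symB typeB)
    (b : M → ℝ) (hb : ContMDiff (𝓡 2) 𝓘(ℝ) ∞ b) :
    P.IsAdmissible B (P.beta symB b) ∧
      ∀ ε ∈ P.killingSpinors (P.beta symB b), ∀ X ζ, SpinStructure.SmoothVF X →
        P.SmoothSpinor ζ →
          P.lieForm (P.beta symB b) (fun x ↦ P.diracCurrent B x (ε x) (ε x)) X ζ = 0 := by
  obtain ⟨l, hl⟩ := hB.exists_eq_area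
  have hLie : ∀ ε ∈ P.killingSpinors (P.beta symB b), ∀ X ζ, SpinStructure.SmoothVF X →
      P.SmoothSpinor ζ →
        P.lieForm (P.beta symB b) (fun x ↦ P.diracCurrent B x (ε x) (ε x)) X ζ = 0 :=
    fun _ hε _ _ hX hζ ↦ SpinStructure.lieForm_beta hl hb hε hX hζ
  exact ⟨⟨fun _ _ hX hζ ↦ SpinStructure.smoothSpinor_beta hb hX hζ,
    fun x e ↦ SpinStructure.inner_skew_of_comp
      (SpinStructure.comp_gammaEnd hl x e),
    SpinStructure.cocycle_beta hl, hLie⟩, hLie⟩
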